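/- Let $d\ge 1$, $n,p\ge 0$ be integers. Consider the hyperbolic system $\partial_t w+\mathbf A\cdot\nabla w=0$ in $\mathbb R^d$, where $\mathbf A=(A_1,\dots,A_d)$ are constant real $n\times n$ matrices such that $\mathbf A\cdot\boldsymbol\xi=\sum_i\xi_iA_i$ is diagonalizable over $\mathbb R$ for every $\boldsymbol\xi\in\mathbb R^d$. For $B=S\Lambda S^{-1}$ with $\Lambda$ real diagonal put $|B|=S|\Lambda|S^{-1}$. Let $\mathbb R^d$ be covered by a conforming, locally finite simplicial mesh invariant under translations by all vectors of $\mathbb Z^d$. Let $\mathcal E$ be its set of ($d$-dimensional) elements, $K_j$ the closed simplex of $j\in\mathcal E$, $|K_j|$ its volume, $N(j)$ the set of $k\ne j$ such that $\partial K_j\cap\partial K_k$ has nonzero $(d-1)$-dimensional measure, and $\mathbf n_{jk}=\int_{\partial K_j\cap\partial K_k}\mathbf n\,dS$, where $\mathbf n$ is the unit normal oriented inside $K_k$. Let $\Pi$ map a continuous function to its averages over the $K_j$, $j\in\mathcal E$. Let $P_q$ be the space of polynomials in $d$ variables with complex coefficients and total degree at most $q$. For each $j\in\mathcal E$ let a finite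 stencil $S_j\subset\mathcal E$ with $|S_j|\ge\dim P_p$ and weights $w_{jk}>0$ $(k\in S_j)$ be given, both invariant under integer translations of the mesh. For $u\in\mathbb C^{\mathcal E}$ let $p_j\in P_p$ be the polynomial such that: if $|S_j|=\dim P_p$, then $\frac1{|K_k|}\int_{K_k}p_j\,dv=u_k$ for all $k\in S_j$; if $|S_j|>\dim P_p$, then $p_j$ minimizes $\sum_{k\in S_j}w_{jk}\bigl|u_k-\frac1{|K_k|}\int_{K_k}p_j\,dv\bigr|^2$ among the polynomials in $P_p$ whose average over $K_j$ is $u_j$. It is assumed that for all $j$ and $u$ there is exactly one such polynomial. Define $\mathcal R_{jk}[u]$ as the average of $p_j$ over the face $\partial K_j\cap\partial K_k$, extended componentwise to $u\in(\mathbb C^{\mathcal E})^n$, and let $$F_{jk}[u]=\frac{\mathbf A\cdot\mathbf n_{jk}+|\mathbf A\cdot\mathbf n_{jk}|}{2}\mathcal R_{jk}[u]+\frac{\mathbf A\cdot\mathbf n_{jk}-|\mathbf A\cdot\mathbf n_{jk}|}{2}\mathcal R_{kj}[u].$$ The truncation error of the finite-volume scheme $\frac{du_j}{dt}+\frac1{|K_j|}\sum_{k\in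 N(j)}F_{jk}[u]=0$ on a smooth function $f:\mathbb R^d\to\mathbb C^n$ is $$\epsilon_j(f,\Pi)=-(\Pi(\mathbf A\cdot\nabla f))_j+\frac1{|K_j|}\sum_{k\in N(j)}F_{jk}[\Pi f],\qquad j\in\mathcal E.$$ Then the scheme is $p$-exact, i.e. $\epsilon_j(f,\Pi)=0$ for all $f\in(P_p)^n$ and $j\in\mathcal E$, and it has zero mean error on the $(p+1)$-th order polynomials: for each set $\mathcal E^1\subset\mathcal E$ containing exactly one element of every class of elements modulo integer translations, $$\sum_{j\in\mathcal E^1}|K_j|\,\epsilon_j(f,\Pi)=0\qquad\text{for each } f\in(P_{p+1})^n.$$ -/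

import Mathlib

open MeasureTheory
open scoped MeasureTheory

noncomputable section

namespace FV

/-- The space `ℝ^d` with its Euclidean structure. -/
abbrev E (d : ℕ) : Type := EuclideanSpace ℝ (Fin d)

/-- A vector with integer components. -/
def latticeVec {d : ℕ} (T : Fin d → ℤ) : E d := WithLp.toLp 2 fun i => (T i : ℝ)

/-- The translate of a finite vertex set by an integer vector. -/
def translate {d : ℕ} (T : Fin d → ℤ) (s : Finset (E d)) : Finset (E d) :=
  s.map (addRightEmbedding (latticeVec T))

/-- A conforming simplicial mesh of `ℝ^d`, invariant under all integer translations. The elements are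
the `d`-dimensional simplices of the complex; they cover `ℝ^d`, and only finitely many of them meet
a given ball. -/
structure PeriodicMesh (d : ℕ) extends Geometry.SimplicialComplex ℝ (E d) where
  translate_mem : ∀ (T : Fin d → ℤ) (s : Finset (E d)), s ∈ faces → translate T s ∈ faces
  covers : ∀ x : E d, ∃ s ∈ faces, s.card = d + 1 ∧ x ∈ convexHull ℝ (s : Set (E d))
  locallyFinite : ∀ r : ℝ, {s : Finset (E d) | s ∈ faces ∧ s.card = d + 1 ∧
    (convexHull ℝ (s : Set (E d)) ∩ Metric.closedBall 0 r).Nonempty}.Finite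

namespace PeriodicMesh

variable {d : ℕ} (M : PeriodicMesh d)

/-- Mesh elements; for a cell-centered scheme these index the control volumes. -/
def Cell : Type := {s : Finset (E d) // s ∈ M.faces ∧ s.card = d + 1}

variable {M}

/-- The shape `K_j` of a control volume. -/
def Cell.shape (j : M.Cell) : Set (E d) := convexHull ℝ (j.1 : Set (E d))

/-- The volume `|K_j|`. -/
def Cell.vol (j : M.Cell) : ℝ := volume.real j.shape

/-- The image of an element under an integer translation. -/
def Cell.shift (T : Fin d → ℤ) (j : M.Cell) : M.Cell :=
  ⟨translate T j.1, M.translate_mem T j.1 j.2.1, by rw [translate, Finset.card_map]; exact j.2.2⟩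

/-- Two elements are equivalent if one is the image of the other under an integer translation. -/
def Cell.Equivalent (j k : M.Cell) : Prop := ∃ T : Fin d → ℤ, k = j.shift T

/-- The common part `∂K_j ∩ ∂K_k` of two boundaries. -/
def face (j k : M.Cell) : Set (E d) := frontier j.shape ∩ frontier k.shape

/-- The `(d-1)`-dimensional surface measure on `ℝ^d` (the counting measure for `d = 1`). -/
def surf (d : ℕ) : Measure (E d) := Measure.euclideanHausdorffMeasure (d - 1)

/-- The set `N(j)` of the elements sharing with `j` a face of nonzero surface measure. -/
def nbrSet (j : M.Cell) : Set M.Cell := {k | k ≠ j ∧ surf d (face j k) ≠ 0}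

theorem nbrSet_finite (j : M.Cell) : (nbrSet j).Finite := by
  have hb : Bornology.IsBounded j.shape :=
    isBounded_convexHull.2 j.1.finite_toSet.isBounded
  obtain ⟨r, hr⟩ := hb.subset_closedBall (0 : E d)
  have hc : ∀ k : M.Cell, IsClosed k.shape := fun k =>
    (k.1.finite_toSet.isCompact_convexHull ℝ).isClosed
  refine Set.Finite.of_finite_image (f := Subtype.val)
    ((M.locallyFinite r).subset ?_) Subtype.val_injective.injOn
  rintro _ ⟨k, ⟨-, hk⟩, rfl⟩
  have hne : (face j k).Nonempty := by
    by_contra h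
    rw [Set.not_nonempty_iff_eq_empty] at h
    exact hk (by rw [h, measure_empty])
  obtain ⟨x, hxj, hxk⟩ := hne
  exact ⟨k.2.1, k.2.2, x, (hc k).frontier_subset hxk, hr ((hc j).frontier_subset hxj)⟩

/-- `N(j)` as a finite set. -/
def nbrs (j : M.Cell) : Finset M.Cell := (nbrSet_finite j).toFinset

/-- `ν` is a unit normal to the planar face `∂K_j ∩ ∂K_k` which points into `K_k`. -/
def IsUnitNormal (j k : M.Cell) (ν : E d) : Prop :=
  ‖ν‖ = 1 ∧ (∀ x ∈ face j k, ∀ y ∈ face j k, inner ℝ ν (y - x) = 0) ∧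
    ∀ x ∈ face j k, ∀ z ∈ k.shape, 0 ≤ inner ℝ ν (z - x)

open Classical in
/-- The unit normal to the face between `j` and `k ∈ N(j)`, oriented inside `K_k`. -/
def unitNormal (j k : M.Cell) : E d :=
  if h : ∃ ν, IsUnitNormal j k ν then h.choose else 0

/-- The oriented area `n_{jk}`, the integral of the unit normal over the face. -/
def normal (j k : M.Cell) : E d := ∫ _x in face j k, unitNormal j k ∂(surf d)

/-- `R` contains exactly one element of each translation class. -/
def IsPeriodCell (R : Finset M.Cell) : Prop := ∀ j : M.Cell, ∃! k, k ∈ R ∧ j.Equivalent k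

theorem Cell.shift_shift (S T : Fin d → ℤ) (j : M.Cell) :
    (j.shift S).shift T = j.shift (S + T) := by
  apply Subtype.ext
  simp only [Cell.shift, translate, Finset.map_map]
  congr 1
  ext x i
  simp [latticeVec, add_assoc]

theorem Cell.shift_zero (j : M.Cell) : j.shift 0 = j := by
  apply Subtype.ext
  simp only [Cell.shift, translate]
  ext x
  have : (latticeVec (0 : Fin d → ℤ)) = 0 := by ext i; simp [latticeVec]
  simp [this]

theorem Cell.equivalence : Equivalence (Cell.Equivalent (M := M)) where
  refl j := ⟨0, j.shift_zero.symm⟩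
  symm := by
    rintro j _ ⟨T, rfl⟩
    exact ⟨-T, by rw [Cell.shift_shift, add_neg_cancel, Cell.shift_zero]⟩
  trans := by
    rintro j _ _ ⟨S, rfl⟩ ⟨T, rfl⟩
    exact ⟨S + T, Cell.shift_shift S T j⟩

/-- A set of representatives of the elements modulo integer translations exists. -/
theorem exists_isPeriodCell (M : PeriodicMesh d) : ∃ R : Finset M.Cell, IsPeriodCell R := by
  classical
  let s : Setoid M.Cell := ⟨Cell.Equivalent, Cell.equivalence⟩
  let B : Set M.Cell := {j | (j.shape ∩ Metric.closedBall 0 (Real.sqrt d)).Nonempty}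
  have hB : B.Finite := by
    refine Set.Finite.of_finite_image (f := Subtype.val)
      ((M.locallyFinite (Real.sqrt d)).subset ?_) Subtype.val_injective.injOn
    rintro _ ⟨k, hk, rfl⟩
    exact ⟨k.2.1, k.2.2, hk⟩
  have hmeet : ∀ j : M.Cell, ∃ T, j.shift T ∈ B := by
    intro j
    obtain ⟨v, hv⟩ : j.1.Nonempty := by
      rw [← Finset.card_pos, j.2.2]; omega
    refine ⟨fun i => -⌊v i⌋, v + latticeVec (fun i => -⌊v i⌋), ?_, ?_⟩
    · apply subset_convexHull
      simp only [Cell.shift, translate, Finset.coe_map]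
      exact ⟨v, hv, rfl⟩
    · rw [mem_closedBall_zero_iff, EuclideanSpace.norm_eq]
      apply Real.sqrt_le_sqrt
      calc ∑ i, ‖(v + latticeVec (fun i => -⌊v i⌋)) i‖ ^ 2 ≤ ∑ _i : Fin d, (1 : ℝ) := by
            refine Finset.sum_le_sum fun i _ => ?_
            have e : (v + latticeVec (fun i => -⌊v i⌋)) i = Int.fract (v i) := by
              simp [latticeVec, Int.fract, sub_eq_add_neg]
            rw [e, Real.norm_eq_abs, sq_abs]
            have h0 := Int.fract_nonneg (v i)
            have h1 := (Int.fract_lt_one (v i)).le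
            nlinarith
        _ = d := by simp
  have hfin : Finite (Quotient s) := by
    have h : Set.range (fun j : B => (Quotient.mk s j.1)) = Set.univ := by
      rw [Set.eq_univ_iff_forall]
      intro q
      obtain ⟨j, rfl⟩ := Quotient.exists_rep q
      obtain ⟨T, hT⟩ := hmeet j
      exact ⟨⟨_, hT⟩, Quotient.sound (s := s) (Cell.equivalence.symm ⟨T, rfl⟩)⟩
    have := hB.to_subtype
    exact Set.finite_univ_iff.1 (h ▸ Set.finite_range _)
  refine ⟨(Set.finite_range (Quotient.out (s := s))).toFinset, fun j => ⟨(Quotient.mk s j).out,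
    ⟨by simp, Cell.equivalence.symm (Quotient.mk_out (s := s) j)⟩, ?_⟩⟩
  rintro k ⟨hk, hjk⟩
  obtain ⟨q, rfl⟩ : k ∈ Set.range (Quotient.out (s := s)) := by simpa using hk
  congr 1
  rw [← Quotient.out_eq q]
  exact (Quotient.sound (s := s) hjk).symm

end PeriodicMesh

open PeriodicMesh

/-- The space `P_p` of polynomials on `ℝ^d` of total degree at most `p`, with complex coefficients,
as functions. -/
def polyFun (d p : ℕ) : Submodule ℂ (E d → ℂ) :=
  (MvPolynomial.restrictTotalDegree (Fin d) ℂ p).map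
    (MvPolynomial.aeval (R := ℂ) fun (i : Fin d) (x : E d) => ((x i : ℝ) : ℂ)).toLinearMap

/-- The space `(P_p)^n`. -/
def IsPolyVec {d n : ℕ} (p : ℕ) (f : E d → Fin n → ℂ) : Prop :=
  ∀ i, (fun x => f x i) ∈ polyFun d p

section Matrices

variable {n : ℕ}

/-- `B = S Λ S⁻¹` with `Λ = diag(l)` real. -/
def IsDiagonalization (B S : Matrix (Fin n) (Fin n) ℝ) (l : Fin n → ℝ) : Prop :=
  IsUnit S.det ∧ B = S * Matrix.diagonal l * S⁻¹

open Classical in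
/-- The absolute value `|B| = S |Λ| S⁻¹` of a real-diagonalizable matrix `B = S Λ S⁻¹`. -/
def matAbs (B : Matrix (Fin n) (Fin n) ℝ) : Matrix (Fin n) (Fin n) ℝ :=
  if h : ∃ Sl : Matrix (Fin n) (Fin n) ℝ × (Fin n → ℝ), IsDiagonalization B Sl.1 Sl.2 then
    h.choose.1 * Matrix.diagonal (fun i => |h.choose.2 i|) * h.choose.1⁻¹
  else 0

/-- `|B|` does not depend on the choice of the diagonalization. -/
theorem matAbs_eq {B S : Matrix (Fin n) (Fin n) ℝ} {l : Fin n → ℝ} (h : IsDiagonalization B S l) :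
    matAbs B = S * Matrix.diagonal (fun i => |l i|) * S⁻¹ := by
  have hex : ∃ Sl : Matrix (Fin n) (Fin n) ℝ × (Fin n → ℝ), IsDiagonalization B Sl.1 Sl.2 :=
    ⟨(S, l), h⟩
  rw [matAbs, dif_pos hex]
  obtain ⟨hQ, hB⟩ := hex.choose_spec
  set Q := hex.choose.1
  set m := hex.choose.2
  obtain ⟨hS, hB'⟩ := h
  have e : S⁻¹ * Q * Matrix.diagonal m = Matrix.diagonal l * (S⁻¹ * Q) := by
    have h1 : S⁻¹ * B * Q = S⁻¹ * Q * Matrix.diagonal m := by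
      rw [hB]; simp only [Matrix.mul_assoc]
      rw [Matrix.nonsing_inv_mul _ hQ, Matrix.mul_one]
    have h2 : S⁻¹ * B * Q = Matrix.diagonal l * (S⁻¹ * Q) := by
      rw [hB']; simp only [← Matrix.mul_assoc]
      rw [Matrix.nonsing_inv_mul _ hS, Matrix.one_mul]
    rw [← h1, h2]
  have e' : S⁻¹ * Q * Matrix.diagonal (fun i => |m i|)
      = Matrix.diagonal (fun i => |l i|) * (S⁻¹ * Q) := by
    ext a b
    have hab := congrFun (congrFun e a) b
    rw [Matrix.mul_diagonal, Matrix.diagonal_mul] at hab ⊢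
    rcases eq_or_ne ((S⁻¹ * Q) a b) 0 with h0 | h0
    · simp [h0]
    · have : m b = l a := by
        apply mul_left_cancel₀ h0
        rw [hab, mul_comm]
      rw [this, mul_comm]
  calc Q * Matrix.diagonal (fun i => |m i|) * Q⁻¹
      = S * (S⁻¹ * Q * Matrix.diagonal (fun i => |m i|)) * Q⁻¹ := by
        simp only [← Matrix.mul_assoc]
        rw [Matrix.mul_nonsing_inv _ hS, Matrix.one_mul]
    _ = S * Matrix.diagonal (fun i => |l i|) * S⁻¹ := by
        rw [e']; simp only [Matrix.mul_assoc]
        rw [Matrix.mul_nonsing_inv _ hQ, Matrix.mul_one]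

variable {d : ℕ}

/-- The matrix `A · v = ∑ v_i A_i`. -/
def dotA (A : Fin d → Matrix (Fin n) (Fin n) ℝ) (v : E d) : Matrix (Fin n) (Fin n) ℝ :=
  ∑ i, v i • A i

/-- The system `w_t + A · ∇w = 0` is hyperbolic: each `A · v` is diagonalizable over `ℝ`. -/
def IsHyperbolic (A : Fin d → Matrix (Fin n) (Fin n) ℝ) : Prop :=
  ∀ v : E d, ∃ S l, IsDiagonalization (dotA A v) S l

/-- A real matrix acting on a complex vector. -/
def act (B : Matrix (Fin n) (Fin n) ℝ) (v : Fin n → ℂ) : Fin n → ℂ :=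
  (B.map Complex.ofReal).mulVec v

/-- `A · ∇f = ∑ A_i ∂f/∂x_i`. -/
def advect (A : Fin d → Matrix (Fin n) (Fin n) ℝ) (f : E d → Fin n → ℂ) (x : E d) : Fin n → ℂ :=
  ∑ i, act (A i) (fderiv ℝ f x (EuclideanSpace.single i 1))

end Matrices

section Scheme

variable {d : ℕ} {M : PeriodicMesh d}

/-- The operator `Π` taking a function to its averages over the elements. -/
def cellAvg {V : Type*} [NormedAddCommGroup V] [NormedSpace ℝ V] (f : E d → V) (j : M.Cell) : V :=
  ⨍ x in j.shape, f x

/-- `q ∈ P_p` is the polynomial reconstructed from the mesh function `u` at the element `j`, with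
stencil `S` and weights `w`. If `|S| = dim P_p`, then `q` has the average `u_k` on each `K_k`, `k ∈ S`.
Otherwise `q` minimizes the weighted sum of squared residuals over `S` among the polynomials of
`P_p` having the average `u_j` on `K_j`. -/
def IsReconstruction (p : ℕ) (S : Finset M.Cell) (w : M.Cell → ℝ) (j : M.Cell)
    (u : M.Cell → ℂ) (q : E d → ℂ) : Prop :=
  q ∈ polyFun d p ∧
    if S.card = Module.finrank ℂ (polyFun d p) then ∀ k ∈ S, cellAvg q k = u k
    else cellAvg q j = u j ∧ ∀ q' ∈ polyFun d p, cellAvg q' j = u j →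
      ∑ k ∈ S, w k * ‖u k - cellAvg q k‖ ^ 2 ≤ ∑ k ∈ S, w k * ‖u k - cellAvg q' k‖ ^ 2

/-- The data of a `p`-th order polynomial reconstruction: translation-invariant stencils
`S_j` and positive weights `w_{jk}`, such that the reconstruction problem has exactly one solution. -/
structure PolyReconstruction (M : PeriodicMesh d) (p : ℕ) where
  stencil : M.Cell → Finset M.Cell
  weight : M.Cell → M.Cell → ℝ
  finrank_le : ∀ j, Module.finrank ℂ (polyFun d p) ≤ (stencil j).card
  weight_pos : ∀ j, ∀ k ∈ stencil j, 0 < weight j k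
  mem_stencil_shift : ∀ (T : Fin d → ℤ) (j k : M.Cell),
    k.shift T ∈ stencil (j.shift T) ↔ k ∈ stencil j
  weight_shift : ∀ (T : Fin d → ℤ) (j : M.Cell), ∀ k ∈ stencil j,
    weight (j.shift T) (k.shift T) = weight j k
  wellPosed : ∀ (j : M.Cell) (u : M.Cell → ℂ),
    ∃! q : E d → ℂ, IsReconstruction p (stencil j) (weight j) j u q

variable {p n : ℕ}

/-- The reconstructed polynomial `p_j`. -/
def PolyReconstruction.poly (𝓡 : PolyReconstruction M p) (j : M.Cell) (u : M.Cell → ℂ) : E d → ℂ :=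
  (𝓡.wellPosed j u).choose

/-- The operator `R_{jk}`: the face average of `p_j`, componentwise. -/
def PolyReconstruction.recon (𝓡 : PolyReconstruction M p) (j k : M.Cell)
    (u : M.Cell → Fin n → ℂ) : Fin n → ℂ :=
  fun i => ⨍ x in face j k, 𝓡.poly j (fun l => u l i) x ∂(surf d)

/-- The upwind numerical flux `F_{jk}`. -/
def PolyReconstruction.flux (𝓡 : PolyReconstruction M p) (A : Fin d → Matrix (Fin n) (Fin n) ℝ)
    (j k : M.Cell) (u : M.Cell → Fin n → ℂ) : Fin n → ℂ :=
  act ((1 / 2 : ℝ) • (dotA A (normal j k) + matAbs (dotA A (normal j k)))) (𝓡.recon j k u) +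
    act ((1 / 2 : ℝ) • (dotA A (normal j k) - matAbs (dotA A (normal j k)))) (𝓡.recon k j u)

/-- The truncation error `ε_j(f, Π)` of the finite-volume scheme
`du_j/dt + |K_j|⁻¹ ∑_{k ∈ N(j)} F_{jk}[u] = 0` with numerical fluxes `F`, for the system
`w_t + A · ∇w = 0`. -/
def truncError (A : Fin d → Matrix (Fin n) (Fin n) ℝ)
    (F : M.Cell → M.Cell → (M.Cell → Fin n → ℂ) → Fin n → ℂ)
    (f : E d → Fin n → ℂ) (j : M.Cell) : Fin n → ℂ :=
  -cellAvg (advect A f) j + (j.vol)⁻¹ • ∑ k ∈ nbrs j, F j k (fun l => cellAvg f l)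

/-- The scheme is `p`-exact: zero truncation error on `(P_p)^n`. -/
def IsExact (A : Fin d → Matrix (Fin n) (Fin n) ℝ)
    (F : M.Cell → M.Cell → (M.Cell → Fin n → ℂ) → Fin n → ℂ) (p : ℕ) : Prop :=
  ∀ f : E d → Fin n → ℂ, IsPolyVec p f → ∀ j, truncError A F f j = 0

/-- The scheme has zero mean error on polynomials of order `q`: the volume-weighted sum of the
truncation errors over the mesh elements of one period vanishes on `(P_q)^n`. -/
def HasZeroMeanError (A : Fin d → Matrix (Fin n) (Fin n) ℝ)
    (F : M.Cell → M.Cell → (M.Cell → Fin n → ℂ) → Fin n → ℂ) (q : ℕ) : Prop :=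
  ∀ R : Finset M.Cell, IsPeriodCell R → ∀ f : E d → Fin n → ℂ, IsPolyVec q f →
    ∑ j ∈ R, j.vol • truncError A F f j = 0

end Scheme

end FV

end

/-!
The volume-weighted truncation error of a cell is a sum over its faces of flux defects, which are
local, antisymmetric, and depend only on the reconstruction error.

By the divergence theorem on the simplex `K_j`, the average of `A · ∇f` is the sum over the faces of
the exact fluxes `(A · n_jk) ⨍ f`. The two halves of the upwind splitting add up to `A · n_jk`, so
subtracting the exact flux from `F_jk[Π f]` leaves the splitting applied to the face averages of
the errors `p_j - f` and `p_k - f` (`flux_eq`, `truncError_eq`). Uniqueness of the reconstruction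
gives `p_j = f` for `f ∈ P_p` (`poly_cellAvg`), and exactness follows. It also gives, without any
appeal to linearity of the least-squares problem, that adding the averages of `g ∈ P_p` to the data
adds `g` to the reconstruction (`poly_add`). Since `f (x + T) - f x` lies in `P_p` for
`f ∈ P_{p+1}` (`shift_sub_mem_polyFun`), the flux defects of such an `f` are invariant under integer
translations (`faceError_shift`, `fluxDefect_shift`). They change sign when the two cells are
exchanged (`fluxDefect_comm`), because `n_kj = -n_jk` and `|-B| = |B|`. An antisymmetric
translation-invariant family sums to zero over the faces of one period (`sum_nbrs_eq_zero`).

The divergence theorem (`integral_convexHull_fderiv`) is obtained from Fubini along the edges. For a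
barycentric coordinate `φ` and a direction `v` with `dφ(v) = 1`, Lebesgue measure is the product of
`dt` and of the surface measure of the hyperplane `φ = 0` divided by `‖∇φ‖`
(`measurePreserving_add_smul`). A line parallel to the edge from `c` to `a` enters the simplex
through the facet opposite to `a` and leaves it through the facet opposite to `c`; the affine map
exchanging the two vertices preserves volume, hence carries one normalized facet measure to the
other. On the mesh, each facet of an element is shared with exactly one other element, on the other
side (`exists_adjacentAcross_of_vertex`, `AdjacentAcross.unique`,
`AdjacentAcross.bary_opposite_neg`), while smaller common faces have surface measure zero, so that
the sum over the facets is a sum over `N(j)` (`integral_shape_fderiv`).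
-/

noncomputable section

namespace FV

open PeriodicMesh

/-! ### Surface measure on level sets of affine functionals -/

section Coarea

variable {d : ℕ}

/-- The gradient of an affine functional. -/
def affineGrad (φ : E d →ᵃ[ℝ] ℝ) : E d :=
  (InnerProductSpace.toDual ℝ (E d)).symm φ.linear.toContinuousLinearMap

theorem inner_affineGrad (φ : E d →ᵃ[ℝ] ℝ) (v : E d) :
    inner ℝ (affineGrad φ) v = φ.linear v := by
  rw [affineGrad, InnerProductSpace.toDual_symm_apply]
  rfl

theorem affineMap_apply_add_smul (φ : E d →ᵃ[ℝ] ℝ) (x v : E d) (t : ℝ) :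
    φ (x + t • v) = φ x + t * φ.linear v := by
  have h := φ.map_vadd x (t • v)
  rw [vadd_eq_add, vadd_eq_add, map_smul, smul_eq_mul, add_comm] at h
  rw [h, add_comm]

theorem affineMap_apply_sub (φ : E d →ᵃ[ℝ] ℝ) (x y : E d) :
    φ.linear (x - y) = φ x - φ y := φ.linearMap_vsub x y

theorem affineGrad_ne_zero {φ : E d →ᵃ[ℝ] ℝ} {v : E d} (hv : φ.linear v = 1) :
    affineGrad φ ≠ 0 := by
  intro h
  have := inner_affineGrad φ v
  rw [h, inner_zero_left, hv] at this
  exact zero_ne_one this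

theorem measurableSet_affine_eq (φ : E d →ᵃ[ℝ] ℝ) (t : ℝ) : MeasurableSet {x | φ x = t} :=
  (isClosed_singleton.preimage φ.continuous_of_finiteDimensional).measurableSet

/-- The surface measure on the hyperplane `φ = 0`, divided by the length of the gradient of `φ`.
With this normalization, Lebesgue measure is the product of this measure with `dt` in the
coordinates `(y, t) ↦ y + t v`, whenever `φ` grows at unit rate along `v`. -/
def levelMeasure (φ : E d →ᵃ[ℝ] ℝ) : Measure (E d) :=
  ‖affineGrad φ‖₊⁻¹ • (surf d).restrict {x | φ x = 0}

instance sFinite_levelMeasure (φ : E d →ᵃ[ℝ] ℝ) : SFinite (levelMeasure φ) := by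
  by_cases hg : affineGrad φ = 0
  · -- for a constant functional the normalizing factor is `0⁻¹ = 0`
    rw [levelMeasure, hg, nnnorm_zero, inv_zero, zero_smul]; infer_instance
  suffices SFinite ((surf d).restrict {x | φ x = 0}) by unfold levelMeasure; infer_instance
  by_cases hne : ∃ p, φ p = 0
  swap
  · have : {x | φ x = 0} = ∅ := by
      ext x; simpa using fun h => hne ⟨x, h⟩
    rw [this, Measure.restrict_empty]; infer_instance
  obtain ⟨p, hp⟩ := hne
  have hiso : Isometry (fun z : (ℝ ∙ affineGrad φ)ᗮ => (z : E d) + p) :=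
    (isometry_add_right p).comp isometry_subtype_coe
  have hrank : Module.finrank ℝ ((ℝ ∙ affineGrad φ)ᗮ : Submodule ℝ (E d)) = d - 1 := by
    have h := (ℝ ∙ affineGrad φ).finrank_add_finrank_orthogonal
    rw [finrank_span_singleton hg, finrank_euclideanSpace_fin] at h
    omega
  have hrange : Set.range (fun z : (ℝ ∙ affineGrad φ)ᗮ => (z : E d) + p) = {x | φ x = 0} := by
    ext x
    constructor
    · rintro ⟨z, rfl⟩
      have hz := Submodule.mem_orthogonal_singleton_iff_inner_right.1 z.2
      have h := φ.map_vadd p (z : E d)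
      rw [vadd_eq_add, vadd_eq_add, ← inner_affineGrad, hz, hp, zero_add] at h
      exact h
    · intro hx
      refine ⟨⟨x - p, Submodule.mem_orthogonal_singleton_iff_inner_right.2 ?_⟩, by simp⟩
      rw [inner_affineGrad, affineMap_apply_sub, hp, sub_zero]
      exact hx
  rw [surf, ← hrange, ← hiso.map_euclideanHausdorffMeasure, ← hrank,
    InnerProductSpace.euclideanHausdorffMeasure_eq_volume]
  infer_instance

/-- Lebesgue measure is the integral of the surface measures of the level sets of `φ`, up to the
factor `‖∇φ‖`. -/
theorem volume_eq_lintegral_surf {φ : E d →ᵃ[ℝ] ℝ} (hg : affineGrad φ ≠ 0) {B : Set (E d)}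
    (hB : MeasurableSet B) :
    volume B = ‖affineGrad φ‖₊⁻¹ • ∫⁻ t : ℝ, surf d (B ∩ {x | φ x = t}) := by
  set g := affineGrad φ with hgdef
  have hng : ‖g‖ ≠ 0 := norm_ne_zero_iff.2 hg
  set w : E d := (‖g‖ ^ 2)⁻¹ • g with hw
  have hw0 : w ≠ 0 := smul_ne_zero (inv_ne_zero (pow_ne_zero 2 hng)) hg
  have hφg : φ.linear g = ‖g‖ ^ 2 := by
    rw [← inner_affineGrad, ← hgdef, real_inner_self_eq_norm_sq]
  have hφw : φ.linear w = 1 := by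
    rw [hw, map_smul, hφg, smul_eq_mul, inv_mul_cancel₀ (pow_ne_zero 2 hng)]
  have hnw : ‖w‖ₑ = (‖g‖₊⁻¹ : NNReal) := by
    rw [enorm_eq_nnnorm, ENNReal.coe_inj]
    apply NNReal.eq
    rw [coe_nnnorm, hw, norm_smul, NNReal.coe_inv, coe_nnnorm, norm_inv, norm_pow, norm_norm]
    field_simp
  have hp : φ ((-φ 0) • w) = 0 := by
    have := affineMap_apply_add_smul φ 0 w (-φ 0)
    rw [zero_add] at this
    rw [this, hφw]; ring
  have h := EuclideanGeometry.euclideanHausdorffMeasure_eq_lintegral ((-φ 0) • w) hw0 hB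
  rw [finrank_euclideanSpace_fin, EuclideanSpace.euclideanHausdorffMeasure_eq_volume, hnw] at h
  rw [h, ENNReal.smul_def, smul_eq_mul]
  congr 1
  refine lintegral_congr fun t => ?_
  rw [surf]
  congr 2
  ext x
  rw [SetLike.mem_coe, AffineSubspace.mem_mk', Submodule.mem_orthogonal_singleton_iff_inner_right,
    hw, real_inner_smul_left, inner_affineGrad, vsub_eq_sub, affineMap_apply_sub, ← hw,
    vadd_eq_add, add_comm, affineMap_apply_add_smul, hp, hφw]
  simp [hng, sub_eq_zero]

instance isAddRightInvariant_surf : (surf d).IsAddRightInvariant := by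
  unfold surf; infer_instance

/-- Fubini's theorem in the oblique coordinates `(y, t) ↦ y + t v` with `y` in the hyperplane
`φ = 0`: the slice at `t` is a translate of the slice of Lebesgue measure at `φ = t`. -/
theorem measurePreserving_add_smul {φ : E d →ᵃ[ℝ] ℝ} {v : E d} (hv : φ.linear v = 1) :
    MeasurePreserving (fun z : E d × ℝ => z.1 + z.2 • v) ((levelMeasure φ).prod volume)
      volume := by
  have hm : Measurable (fun z : E d × ℝ => z.1 + z.2 • v) := by fun_prop
  refine ⟨hm, ?_⟩
  ext B hB
  rw [Measure.map_apply hm hB, Measure.prod_apply_symm (hm hB),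
    volume_eq_lintegral_surf (affineGrad_ne_zero hv) hB]
  simp only [levelMeasure, Measure.smul_apply, ENNReal.smul_def, smul_eq_mul]
  rw [← lintegral_const_mul' _ _ ENNReal.coe_ne_top]
  refine lintegral_congr fun t => ?_
  congr 1
  rw [Measure.restrict_apply]
  · rw [← measure_preimage_add_right (surf d) (t • v) (B ∩ _)]
    congr 1
    ext y
    simp [affineMap_apply_add_smul, hv]
  · exact measurable_prodMk_right (hm hB)

instance isFiniteMeasureOnCompacts_levelMeasure (φ : E d →ᵃ[ℝ] ℝ) :
    IsFiniteMeasureOnCompacts (levelMeasure φ) where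
  lt_top_of_isCompact K hK := by
    by_cases hg : affineGrad φ = 0
    · rw [levelMeasure, hg, nnnorm_zero, inv_zero, zero_smul]; simp
    set v : E d := (‖affineGrad φ‖ ^ 2)⁻¹ • affineGrad φ with hvdef
    have hv : φ.linear v = 1 := by
      rw [hvdef, map_smul, ← inner_affineGrad, real_inner_self_eq_norm_sq, smul_eq_mul,
        inv_mul_cancel₀ (pow_ne_zero 2 (norm_ne_zero_iff.2 hg))]
    -- `K × [0, 1]` has the same product measure as `K`, and a bounded image
    have hc : IsCompact ((fun z : E d × ℝ => z.1 + z.2 • v) '' (K ×ˢ Set.Icc 0 1)) :=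
      (hK.prod isCompact_Icc).image (by fun_prop)
    have h : (levelMeasure φ).prod volume (K ×ˢ Set.Icc (0 : ℝ) 1) < ⊤ := by
      refine (measure_mono (Set.subset_preimage_image (fun z : E d × ℝ => z.1 + z.2 • v) _)).trans_lt ?_
      rw [(measurePreserving_add_smul hv).measure_preimage hc.measurableSet.nullMeasurableSet]
      exact hc.measure_lt_top
    rw [Measure.prod_prod] at h
    simpa using h

/-- The level measure of `φ` is the projection along `v` of Lebesgue measure on `0 ≤ φ ≤ 1`. -/
theorem levelMeasure_apply_eq_volume {φ : E d →ᵃ[ℝ] ℝ} {v : E d} (hv : φ.linear v = 1)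
    {B : Set (E d)} (hB : MeasurableSet B) :
    levelMeasure φ B = volume {x | 0 ≤ φ x ∧ φ x ≤ 1 ∧ x - φ x • v ∈ B} := by
  have hφ : Measurable φ := φ.continuous_of_finiteDimensional.measurable
  have hm : MeasurableSet {x | 0 ≤ φ x ∧ φ x ≤ 1 ∧ x - φ x • v ∈ B} :=
    (measurableSet_le measurable_const hφ).inter ((measurableSet_le hφ measurable_const).inter
      ((measurable_id.sub (hφ.smul_const v)) hB))
  have hprod : levelMeasure φ B = (levelMeasure φ).prod volume (B ×ˢ Set.Icc (0 : ℝ) 1) := by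
    rw [Measure.prod_prod]; simp
  rw [← (measurePreserving_add_smul hv).measure_preimage hm.nullMeasurableSet, hprod]
  apply measure_congr
  have hae : ∀ᵐ z ∂(levelMeasure φ).prod (volume : Measure ℝ), φ z.1 = 0 := by
    have : ∀ᵐ y ∂levelMeasure φ, φ y = 0 :=
      Measure.ae_smul_measure (ae_restrict_mem (measurableSet_affine_eq φ 0)) _
    exact Measure.quasiMeasurePreserving_fst.ae this
  filter_upwards [hae] with z hz
  apply propext
  change (z.1 ∈ B ∧ 0 ≤ z.2 ∧ z.2 ≤ 1) ↔ (0 ≤ φ (z.1 + z.2 • v) ∧ φ (z.1 + z.2 • v) ≤ 1 ∧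
    z.1 + z.2 • v - φ (z.1 + z.2 • v) • v ∈ B)
  rw [affineMap_apply_add_smul, hz, hv, zero_add, mul_one, add_sub_cancel_right]
  tauto

/-- A volume-preserving affine map under which `ψ` pulls back to `φ` carries the level measure of
`φ` to that of `ψ`, because the level measures are projections of Lebesgue measure. -/
theorem measurePreserving_levelMeasure {φ ψ : E d →ᵃ[ℝ] ℝ} {v : E d} (hv : φ.linear v = 1)
    (ρ : E d →ᵃ[ℝ] E d) (hρ : MeasurePreserving ρ volume volume) (hφ : ∀ x, ψ (ρ x) = φ x) :
    MeasurePreserving ρ (levelMeasure φ) (levelMeasure ψ) := by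
  have hm : Measurable ρ := ρ.continuous_of_finiteDimensional.measurable
  refine ⟨hm, ?_⟩
  have hψ : ψ.linear (ρ.linear v) = 1 := by
    have h1 := affineMap_apply_sub ψ (ρ (0 + v)) (ρ 0)
    rw [hφ, hφ, ← affineMap_apply_sub, add_sub_cancel_left, hv] at h1
    have h2 : ρ (0 + v) - ρ 0 = ρ.linear v := by
      rw [← vsub_eq_sub, ← ρ.linearMap_vsub, vsub_eq_sub, add_sub_cancel_left]
    rwa [h2] at h1
  ext B hB
  rw [Measure.map_apply hm hB, levelMeasure_apply_eq_volume hv (hm hB),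
    levelMeasure_apply_eq_volume hψ hB]
  have hψm : Measurable ψ := ψ.continuous_of_finiteDimensional.measurable
  have hs : MeasurableSet {x | 0 ≤ ψ x ∧ ψ x ≤ 1 ∧ x - ψ x • ρ.linear v ∈ B} :=
    (measurableSet_le measurable_const hψm).inter ((measurableSet_le hψm measurable_const).inter
      ((measurable_id.sub (hψm.smul_const (ρ.linear v))) hB))
  rw [← hρ.measure_preimage hs.nullMeasurableSet]
  congr 1
  ext x
  have : ρ (x - φ x • v) = ρ x - φ x • ρ.linear v := by
    have := ρ.map_vadd x (-(φ x • v))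
    rw [vadd_eq_add, vadd_eq_add, map_neg, map_smul] at this
    rw [sub_eq_neg_add, this, sub_eq_neg_add]
  change (0 ≤ φ x ∧ φ x ≤ 1 ∧ ρ (x - φ x • v) ∈ B) ↔ (0 ≤ ψ (ρ x) ∧ ψ (ρ x) ≤ 1 ∧
    ρ x - ψ (ρ x) • ρ.linear v ∈ B)
  rw [hφ, this]

theorem measurePreserving_of_affine_involution (ρ : E d →ᵃ[ℝ] E d) (h : ∀ x, ρ (ρ x) = x) :
    MeasurePreserving ρ volume volume := by
  have hlin : ρ.linear ∘ₗ ρ.linear = LinearMap.id := by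
    ext1 x
    have h1 := ρ.linearMap_vsub x 0
    have h2 := ρ.linearMap_vsub (ρ x) (ρ 0)
    rw [← h1, h, h] at h2
    simpa using h2
  have hdet : LinearMap.det ρ.linear * LinearMap.det ρ.linear = 1 := by
    rw [← LinearMap.det_comp, hlin, LinearMap.det_id]
  have hne : LinearMap.det ρ.linear ≠ 0 := left_ne_zero_of_mul_eq_one hdet
  have habs : |(LinearMap.det ρ.linear)⁻¹| = 1 := by
    rcases mul_self_eq_one_iff.1 hdet with h | h <;> simp [h]
  have hL : MeasurePreserving ρ.linear (volume : Measure (E d)) volume := by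
    refine ⟨ρ.linear.continuous_of_finiteDimensional.measurable, ?_⟩
    rw [Measure.map_linearMap_addHaar_eq_smul_addHaar _ hne, habs]; simp
  have := (measurePreserving_add_right volume (ρ 0)).comp hL
  rw [ρ.decomp]
  exact this

end Coarea

/-! ### The divergence theorem on a simplex -/

section Simplex

variable {d : ℕ} {ι : Type*}

theorem coord_linear_sub [DecidableEq ι] (b : AffineBasis ι ℝ (E d)) (i a c : ι) :
    (b.coord i).linear (b a - b c) = (if i = a then 1 else 0) - (if i = c then 1 else 0) := by
  rw [affineMap_apply_sub, b.coord_apply, b.coord_apply]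

/-- The affine map exchanging the vertices `a` and `c` of a simplex and fixing the others. -/
def vertexSwap (b : AffineBasis ι ℝ (E d)) (a c : ι) : E d →ᵃ[ℝ] E d :=
  AffineMap.id ℝ (E d) + (LinearMap.toSpanSingleton ℝ (E d) (b a - b c)).toAffineMap.comp
    (b.coord c - b.coord a)

theorem vertexSwap_apply (b : AffineBasis ι ℝ (E d)) (a c : ι) (x : E d) :
    vertexSwap b a c x = x + (b.coord c x - b.coord a x) • (b a - b c) := rfl

theorem coord_vertexSwap [DecidableEq ι] (b : AffineBasis ι ℝ (E d)) (a c i : ι) (x : E d) :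
    b.coord i (vertexSwap b a c x) = b.coord (Equiv.swap a c i) x := by
  rw [vertexSwap_apply, affineMap_apply_add_smul, coord_linear_sub]
  by_cases hia : i = a
  · subst hia
    by_cases hc : i = c
    · subst hc; simp
    · simp [hc]
  · by_cases hic : i = c
    · subst hic; simp [hia]
    · rw [Equiv.swap_apply_of_ne_of_ne hia hic]; simp [hia, hic]

theorem vertexSwap_mem_convexHull_iff (b : AffineBasis ι ℝ (E d)) (a c : ι) (x : E d) :
    vertexSwap b a c x ∈ convexHull ℝ (Set.range b) ↔ x ∈ convexHull ℝ (Set.range b) := by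
  classical
  rw [b.convexHull_eq_nonneg_coord]
  change (∀ i, _) ↔ (∀ i, _)
  simp only [coord_vertexSwap]
  exact (Equiv.swap a c).forall_congr_left.trans (by simp)

variable [Fintype ι]

theorem vertexSwap_vertexSwap (b : AffineBasis ι ℝ (E d)) (a c : ι) (x : E d) :
    vertexSwap b a c (vertexSwap b a c x) = x := by
  classical
  refine b.ext_elem fun i => ?_
  rw [coord_vertexSwap, coord_vertexSwap, Equiv.swap_apply_self]

theorem measurePreserving_vertexSwap (b : AffineBasis ι ℝ (E d)) {a c : ι} (hac : a ≠ c) :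
    MeasurePreserving (vertexSwap b a c) (levelMeasure (b.coord a)) (levelMeasure (b.coord c)) := by
  classical
  refine measurePreserving_levelMeasure (v := b a - b c) ?_ _
    (measurePreserving_of_affine_involution _ (vertexSwap_vertexSwap b a c)) fun x => ?_
  · rw [coord_linear_sub]; simp [hac]
  · rw [coord_vertexSwap]; simp

theorem isCompact_convexHull_range (b : AffineBasis ι ℝ (E d)) :
    IsCompact (convexHull ℝ (Set.range b)) :=
  (Set.finite_range b).isCompact_convexHull ℝ

variable {V : Type*} [NormedAddCommGroup V] [NormedSpace ℝ V] [CompleteSpace V]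

/-- The derivative along an edge, integrated over the lines parallel to this edge: they enter the
simplex through the facet opposite to `a` and leave it through the facet opposite to `c`. -/
theorem integral_convexHull_fderiv_edge (b : AffineBasis ι ℝ (E d)) {f : E d → V}
    (hf : ContDiff ℝ 1 f) {a c : ι} (hac : a ≠ c) :
    ∫ x in convexHull ℝ (Set.range b), fderiv ℝ f x (b a - b c) =
      (∫ x in convexHull ℝ (Set.range b), f x ∂levelMeasure (b.coord c)) -
        ∫ x in convexHull ℝ (Set.range b), f x ∂levelMeasure (b.coord a) := by
  classical
  set K := convexHull ℝ (Set.range b) with hK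
  set v := b a - b c with hv
  have hKc : IsCompact K := isCompact_convexHull_range b
  have hcont : Continuous fun x => fderiv ℝ f x v :=
    (hf.continuous_fderiv one_ne_zero).clm_apply continuous_const
  have hva : (b.coord a).linear v = 1 := by rw [hv, coord_linear_sub]; simp [hac]
  have hmem : ∀ x, x ∈ K ↔ ∀ i, 0 ≤ b.coord i x := fun x => by
    rw [hK, b.convexHull_eq_nonneg_coord]; rfl
  have hmp := measurePreserving_add_smul hva
  have hint : Integrable (K.indicator fun x => fderiv ℝ f x v) :=
    (hcont.continuousOn.integrableOn_compact hKc).integrable_indicator hKc.measurableSet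
  have hint' := (hmp.integrable_comp hint.aestronglyMeasurable).2 hint
  have hae : ∀ᵐ y ∂levelMeasure (b.coord a), b.coord a y = 0 :=
    Measure.ae_smul_measure (ae_restrict_mem (measurableSet_affine_eq _ 0)) _
  have hfi : ∀ {g : E d → V}, Continuous g → ∀ μ : Measure (E d), IsFiniteMeasureOnCompacts μ →
    IntegrableOn g K μ := fun hg μ _ => hg.continuousOn.integrableOn_compact hKc
  calc ∫ x in K, fderiv ℝ f x v
      = ∫ x, K.indicator (fun x => fderiv ℝ f x v) x := (integral_indicator hKc.measurableSet).symm
    _ = ∫ z : E d × ℝ, K.indicator (fun x => fderiv ℝ f x v) (z.1 + z.2 • v)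
          ∂(levelMeasure (b.coord a)).prod volume := by
        rw [← hmp.map_eq, integral_map hmp.measurable.aemeasurable]
        rw [hmp.map_eq]; exact hint.aestronglyMeasurable
    _ = ∫ y, (∫ t : ℝ, K.indicator (fun x => fderiv ℝ f x v) (y + t • v))
          ∂levelMeasure (b.coord a) := integral_prod _ hint'
    _ = ∫ y, K.indicator (fun y => f (vertexSwap b a c y) - f y) y
          ∂levelMeasure (b.coord a) := by
        refine integral_congr_ae ?_
        filter_upwards [hae] with y hy
        have hline : ∀ t : ℝ, y + t • v ∈ K ↔ y ∈ K ∧ t ∈ Set.Icc 0 (b.coord c y) := by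
          intro t
          simp only [hmem, affineMap_apply_add_smul, hv, coord_linear_sub, Set.mem_Icc]
          constructor
          · intro h
            have ha := h a
            have hc := h c
            simp only [if_true, hac, hac.symm, if_false, hy] at ha hc
            refine ⟨fun i => ?_, by linarith, by linarith⟩
            by_cases hia : i = a
            · rw [hia, hy]
            by_cases hic : i = c
            · rw [hic]; linarith
            simpa [hia, hic] using h i
          · rintro ⟨h, h0, h1⟩ i
            by_cases hia : i = a
            · simp [hia, hac, hy, h0]
            by_cases hic : i = c
            · simp [hic, hac.symm, h1]
            simpa [hia, hic] using h i
        by_cases hyK : y ∈ K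
        · rw [Set.indicator_of_mem hyK]
          have h0 : 0 ≤ b.coord c y := (hmem y).1 hyK c
          have e : (fun t : ℝ => K.indicator (fun x => fderiv ℝ f x v) (y + t • v)) =
              (Set.Icc 0 (b.coord c y)).indicator fun t => fderiv ℝ f (y + t • v) v := by
            ext t
            by_cases ht : t ∈ Set.Icc 0 (b.coord c y)
            · rw [Set.indicator_of_mem ht, Set.indicator_of_mem ((hline t).2 ⟨hyK, ht⟩)]
            · rw [Set.indicator_of_notMem ht,
                Set.indicator_of_notMem fun h => ht ((hline t).1 h).2]
          rw [e, integral_indicator measurableSet_Icc, integral_Icc_eq_integral_Ioc,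
            ← intervalIntegral.integral_of_le h0,
            intervalIntegral.integral_eq_sub_of_hasDerivAt (f := fun t : ℝ => f (y + t • v))]
          · rw [zero_smul, add_zero, vertexSwap_apply, hy, sub_zero]
          · intro t _
            have h1 : HasDerivAt (fun t : ℝ => y + t • v) v t := by
              simpa using ((hasDerivAt_id t).smul_const v).const_add y
            exact (((hf.differentiable one_ne_zero) _).hasFDerivAt).comp_hasDerivAt t h1
          · exact (hcont.comp (by fun_prop)).intervalIntegrable _ _
        · rw [Set.indicator_of_notMem hyK]
          have e : (fun t : ℝ => K.indicator (fun x => fderiv ℝ f x v) (y + t • v)) = 0 := by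
            ext t
            exact Set.indicator_of_notMem (fun h => hyK ((hline t).1 h).1) _
          rw [e]; simp
    _ = (∫ y in K, f (vertexSwap b a c y) ∂levelMeasure (b.coord a)) -
          ∫ y in K, f y ∂levelMeasure (b.coord a) := by
        rw [integral_indicator hKc.measurableSet]
        exact integral_sub (hfi (hf.continuous.comp
          (vertexSwap b a c).continuous_of_finiteDimensional) _ inferInstance)
          (hfi hf.continuous _ inferInstance)
    _ = _ := by
        congr 1
        have hmap := measurePreserving_vertexSwap b hac
        rw [← integral_indicator hKc.measurableSet, ← integral_indicator hKc.measurableSet,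
          ← hmap.map_eq, integral_map hmap.measurable.aemeasurable]
        · refine integral_congr_ae (Filter.Eventually.of_forall fun y => ?_)
          change K.indicator _ y = K.indicator f (vertexSwap b a c y)
          by_cases hy : y ∈ K
          · rw [Set.indicator_of_mem hy,
              Set.indicator_of_mem ((vertexSwap_mem_convexHull_iff b a c y).2 hy)]
          · rw [Set.indicator_of_notMem hy,
              Set.indicator_of_notMem fun h => hy ((vertexSwap_mem_convexHull_iff b a c y).1 h)]
        · exact (hf.continuous.aestronglyMeasurable).indicator hKc.measurableSet

/-- The divergence theorem on a simplex, for the fields `f v` with `v` constant. The outward unit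
normal to the facet opposite to the vertex `i` is `-∇λ_i / ‖∇λ_i‖`, and the denominator is part of
`levelMeasure`. -/
theorem integral_convexHull_fderiv (b : AffineBasis ι ℝ (E d)) {f : E d → V}
    (hf : ContDiff ℝ 1 f) (v : E d) :
    ∫ x in convexHull ℝ (Set.range b), fderiv ℝ f x v =
      -∑ i, (b.coord i).linear v •
        ∫ x in convexHull ℝ (Set.range b), f x ∂levelMeasure (b.coord i) := by
  classical
  obtain ⟨c⟩ := b.nonempty
  have hKc : IsCompact (convexHull ℝ (Set.range b)) := isCompact_convexHull_range b
  have hi : ∀ v : E d, IntegrableOn (fun x => fderiv ℝ f x v) (convexHull ℝ (Set.range b)) :=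
    fun v => ((hf.continuous_fderiv one_ne_zero).clm_apply
      continuous_const).continuousOn.integrableOn_compact hKc
  have hv : v ∈ Submodule.span ℝ (Set.range (b.basisOf c)) := by
    rw [(b.basisOf c).span_eq]; trivial
  induction hv using Submodule.span_induction with
  | mem v hv =>
    obtain ⟨⟨a, ha⟩, rfl⟩ := hv
    rw [AffineBasis.basisOf_apply, vsub_eq_sub, integral_convexHull_fderiv_edge b hf ha]
    simp only [coord_linear_sub, sub_smul, ite_smul, one_smul, zero_smul, Finset.sum_sub_distrib,
      Finset.sum_ite_eq', Finset.mem_univ, if_true, neg_sub]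
  | zero => simp
  | add v w _ _ ihv ihw =>
    simp only [map_add, add_smul, Finset.sum_add_distrib, neg_add]
    rw [integral_add (hi v) (hi w), ihv, ihw]
  | smul r v _ ih =>
    simp only [map_smul, smul_eq_mul, mul_smul, ← Finset.smul_sum]
    rw [integral_smul, ih, smul_neg]

end Simplex

/-! ### Facets of the mesh elements and their neighbours -/

section Mesh

open scoped Classical

variable {d : ℕ} {M : PeriodicMesh d}

/-- The vertices of an element, as an affine basis of `ℝ ^ d`. -/
def cellBasis (j : M.Cell) : AffineBasis j.1 ℝ (E d) where
  toFun := Subtype.val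
  ind' := M.indep j.2.1
  tot' := by
    rw [(M.indep j.2.1).affineSpan_eq_top_iff_card_eq_finrank_add_one, finrank_euclideanSpace_fin,
      Fintype.card_coe, j.2.2]

theorem cellBasis_apply (j : M.Cell) (a : j.1) : cellBasis j a = a := rfl

theorem range_cellBasis (j : M.Cell) : Set.range (cellBasis j) = j.1 := Subtype.range_coe

/-- The barycentric coordinate of the element `j` at its vertex `a`. -/
abbrev bary (j : M.Cell) (a : j.1) : E d →ᵃ[ℝ] ℝ := (cellBasis j).coord a

theorem shape_eq (j : M.Cell) : j.shape = convexHull ℝ (Set.range (cellBasis j)) := by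
  rw [range_cellBasis]; rfl

theorem mem_shape_iff (j : M.Cell) (x : E d) : x ∈ j.shape ↔ ∀ a, 0 ≤ bary j a x := by
  rw [shape_eq, AffineBasis.convexHull_eq_nonneg_coord]; rfl

theorem isCompact_shape (j : M.Cell) : IsCompact j.shape :=
  j.1.finite_toSet.isCompact_convexHull ℝ

theorem mem_frontier_shape_iff (j : M.Cell) (x : E d) :
    x ∈ frontier j.shape ↔ x ∈ j.shape ∧ ∃ a, bary j a x = 0 := by
  rw [(isCompact_shape j).isClosed.frontier_eq, Set.mem_sdiff]
  refine and_congr_right fun hx => ?_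
  rw [shape_eq, AffineBasis.interior_convexHull]
  have h := (mem_shape_iff j x).1 hx
  constructor
  · intro h'
    by_contra! h0
    exact h' fun a => (h a).lt_of_ne' (h0 a)
  · rintro ⟨a, ha⟩ h'
    exact (h' a).ne' ha

theorem bary_vertex (j : M.Cell) (a : j.1) {c : E d} (hc : c ∈ j.1) :
    bary j a c = if (a : E d) = c then 1 else 0 := by
  have := (cellBasis j).coord_apply a ⟨c, hc⟩
  rw [cellBasis_apply] at this
  rw [this]
  simp [Subtype.ext_iff]

theorem affineMap_eq_sum_bary (j : M.Cell) (φ : E d →ᵃ[ℝ] ℝ) (x : E d) :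
    φ x = ∑ c : j.1, bary j c x * φ c := by
  conv_lhs => rw [← (cellBasis j).affineCombination_coord_eq_self x]
  rw [Finset.map_affineCombination _ _ _ ((cellBasis j).sum_coord_apply_eq_one x),
    Finset.affineCombination_eq_linear_combination _ _ _ ((cellBasis j).sum_coord_apply_eq_one x)]
  rfl

theorem bary_eq_zero_of_mem_convexHull (j : M.Cell) (a : j.1) {t : Set (E d)} (ht : t ⊆ j.1)
    (ha : (a : E d) ∉ t) {x : E d} (hx : x ∈ convexHull ℝ t) : bary j a x = 0 := by
  have hconv : Convex ℝ {x | bary j a x = 0} :=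
    (convex_singleton (0 : ℝ)).affine_preimage (bary j a)
  refine convexHull_min (fun c hc => ?_) hconv hx
  change bary j a c = 0
  rw [bary_vertex j a (ht hc), if_neg]
  rintro rfl
  exact ha hc

theorem mem_convexHull_of_bary_eq_zero (j : M.Cell) (a : j.1) {x : E d} (hx : x ∈ j.shape)
    (ha : bary j a x = 0) : x ∈ convexHull ℝ (j.1.erase a : Set (E d)) := by
  rw [← (cellBasis j).linear_combination_coord_eq_self x,
    ← Finset.sum_erase Finset.univ (a := a) (by rw [ha, zero_smul])]
  refine (convex_convexHull ℝ _).sum_mem (fun i _ => (mem_shape_iff j x).1 hx i) ?_ fun i hi => ?_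
  · rw [Finset.sum_erase (f := fun i => bary j i x) _ ha, (cellBasis j).sum_coord_apply_eq_one]
  · refine subset_convexHull ℝ _ ?_
    rw [Finset.mem_coe, Finset.mem_erase, cellBasis_apply]
    exact ⟨fun h => (Finset.mem_erase.1 hi).1 (Subtype.ext h), i.2⟩

theorem exists_bary_linear_eq_one (hd : 0 < d) (j : M.Cell) (a : j.1) :
    ∃ v, (bary j a).linear v = 1 := by
  have : 1 < j.1.card := by rw [j.2.2]; omega
  obtain ⟨c, hc, hca⟩ := Finset.exists_mem_ne this a
  refine ⟨a - c, ?_⟩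
  rw [affineMap_apply_sub, bary_vertex j a a.2, bary_vertex j a hc, if_pos rfl, if_neg hca.symm,
    sub_zero]

theorem affineGrad_bary_ne_zero (hd : 0 < d) (j : M.Cell) (a : j.1) :
    affineGrad (bary j a) ≠ 0 := by
  obtain ⟨v, hv⟩ := exists_bary_linear_eq_one hd j a
  exact affineGrad_ne_zero hv

/-- Two different elements which share the facets opposite to their vertices `a` and `b`. -/
def AdjacentAcross (j k : M.Cell) (a : j.1) (b : k.1) : Prop :=
  j ≠ k ∧ j.1.erase a = k.1.erase b

theorem AdjacentAcross.symm {j k : M.Cell} {a : j.1} {b : k.1} (h : AdjacentAcross j k a b) :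
    AdjacentAcross k j b a := ⟨h.1.symm, h.2.symm⟩

theorem AdjacentAcross.notMem {j k : M.Cell} {a : j.1} {b : k.1} (h : AdjacentAcross j k a b) :
    (a : E d) ∉ k.1 := by
  intro ha
  by_cases hab : (a : E d) = b
  · refine h.1 (Subtype.ext ?_)
    rw [← Finset.insert_erase a.2, h.2, hab, Finset.insert_erase b.2]
  · have : (a : E d) ∈ j.1.erase a := by rw [h.2]; exact Finset.mem_erase.2 ⟨hab, ha⟩
    exact (Finset.notMem_erase _ _) this

theorem AdjacentAcross.mem_of_ne {j k : M.Cell} {a : j.1} {b : k.1} (h : AdjacentAcross j k a b)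
    {c : E d} (hc : c ∈ k.1) (hcb : c ≠ b) : c ∈ j.1 ∧ c ≠ a := by
  have : c ∈ j.1.erase a := by rw [h.2]; exact Finset.mem_erase.2 ⟨hcb, hc⟩
  exact ⟨Finset.mem_of_mem_erase this, Finset.ne_of_mem_erase this⟩

theorem exists_adjacentAcross {j k : M.Cell} (hjk : j ≠ k) (a : j.1) (h : j.1.erase a ⊆ k.1) :
    ∃ b, AdjacentAcross j k a b := by
  have hc : (j.1.erase a).card = d := by rw [Finset.card_erase_of_mem a.2, j.2.2]; rfl
  have h1 : (k.1 \ j.1.erase a).card = 1 := by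
    rw [Finset.card_sdiff_of_subset h, hc, k.2.2]; omega
  obtain ⟨b, hb⟩ := Finset.card_eq_one.1 h1
  have hbk : b ∈ k.1 \ j.1.erase a := by rw [hb]; exact Finset.mem_singleton_self b
  refine ⟨⟨b, (Finset.mem_sdiff.1 hbk).1⟩, hjk, ?_⟩
  change _ = k.1.erase b
  rw [← Finset.sdiff_singleton_eq_erase b, ← hb, Finset.sdiff_sdiff_eq_self h]

/-- The barycentric coordinates of two adjacent elements at the vertices opposite to the common
facet are proportional. -/
theorem AdjacentAcross.bary_eq {j k : M.Cell} {a : j.1} {b : k.1} (h : AdjacentAcross j k a b)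
    (x : E d) : bary j a x = bary k b x * bary j a b := by
  rw [affineMap_eq_sum_bary k (bary j a) x, Finset.sum_eq_single b]
  · intro c _ hcb
    have hc := h.mem_of_ne c.2 (fun e => hcb (Subtype.ext e))
    rw [bary_vertex j a hc.1, if_neg hc.2.symm, mul_zero]
  · simp

theorem affineMap_centroid (φ : E d →ᵃ[ℝ] ℝ) {F : Finset (E d)} (hF : F.Nonempty) :
    φ (F.centroid ℝ id) = (F.card : ℝ)⁻¹ * ∑ c ∈ F, φ c := by
  have hw := F.sum_centroidWeights_eq_one_of_nonempty ℝ hF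
  rw [Finset.centroid, Finset.map_affineCombination _ _ _ hw,
    Finset.affineCombination_eq_linear_combination _ _ _ hw, Finset.mul_sum]
  simp

theorem bary_centroid (j : M.Cell) {F : Finset (E d)} (hF : F.Nonempty) (hFj : F ⊆ j.1)
    (c : j.1) : bary j c (F.centroid ℝ id) = if (c : E d) ∈ F then (F.card : ℝ)⁻¹ else 0 := by
  rw [affineMap_centroid _ hF, Finset.sum_congr rfl fun x hx => bary_vertex j c (hFj hx)]
  simp

theorem inter_shape_subset (j k : M.Cell) :
    j.shape ∩ k.shape ⊆ convexHull ℝ (j.1 ∩ k.1 : Set (E d)) :=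
  M.inter_subset_convexHull j.2.1 k.2.1

/-- Adjacent elements lie on different sides of their common facet: otherwise the points close to
the centroid of the facet, on this side, would belong to both elements. -/
theorem AdjacentAcross.bary_opposite_neg (hd : 0 < d) {j k : M.Cell} {a : j.1} {b : k.1}
    (h : AdjacentAcross j k a b) : bary j a b < 0 := by
  by_contra! hnn
  have hne : bary j a b ≠ 0 := by
    intro h0
    have := h.bary_eq a
    rw [h0, mul_zero, bary_vertex j a a.2, if_pos rfl] at this
    exact one_ne_zero this
  have hpos : 0 < bary j a b := hnn.lt_of_ne' hne
  set F := j.1.erase a with hF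
  have hcard : F.card = d := by rw [hF, Finset.card_erase_of_mem a.2, j.2.2]; rfl
  have hFne : F.Nonempty := by rw [← Finset.card_pos, hcard]; exact hd
  have hFj : F ⊆ j.1 := Finset.erase_subset _ _
  have hFk : F ⊆ k.1 := by rw [hF, h.2]; exact Finset.erase_subset _ _
  set x := F.centroid ℝ id with hx
  set y : ℝ → E d := fun t => x + t • (a - x) with hy
  have hbx : ∀ c : j.1, 0 ≤ bary j c x := fun c => by
    rw [hx, bary_centroid j hFne hFj]; positivity
  have hax : bary j a x = 0 := by
    rw [hx, bary_centroid j hFne hFj, if_neg (Finset.notMem_erase _ _)]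
  have hay : ∀ t, bary j a (y t) = t := fun t => by
    rw [hy, affineMap_apply_add_smul, affineMap_apply_sub, hax, bary_vertex j a a.2, if_pos rfl]
    ring
  have hyj : ∀ t ∈ Set.Ioo (0 : ℝ) 1, y t ∈ j.shape := fun t ht => by
    rw [mem_shape_iff]
    intro c
    rw [hy, affineMap_apply_add_smul, affineMap_apply_sub, bary_vertex j c a.2]
    have h1 := hbx c
    have h2 : (0 : ℝ) ≤ if (c : E d) = a then 1 else 0 := by positivity
    nlinarith [ht.1, ht.2]
  have hcont : ∀ c : k.1, Continuous fun t => bary k c (y t) := fun c =>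
    (bary k c).continuous_of_finiteDimensional.comp (by fun_prop)
  -- the `k`-coordinate of `y t` at `b` is a positive multiple of `t`; the other ones start positive
  have hyk : ∀ᶠ t in nhdsWithin (0 : ℝ) (Set.Ioi 0), ∀ c : k.1, 0 ≤ bary k c (y t) := by
    rw [Filter.eventually_all]
    intro c
    by_cases hcb : c = b
    · subst hcb
      filter_upwards [self_mem_nhdsWithin] with t ht
      have := h.bary_eq (y t)
      rw [hay] at this
      by_contra! hneg
      have h3 : bary k c (y t) * bary j a c < 0 := mul_neg_of_neg_of_pos hneg hpos
      rw [← this] at h3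
      exact absurd h3 (not_lt.2 (le_of_lt ht))
    · have hcF : (c : E d) ∈ F := by
        rw [hF, h.2]; exact Finset.mem_erase.2 ⟨fun e => hcb (Subtype.ext e), c.2⟩
      have h0 : 0 < bary k c (y 0) := by
        rw [hy]
        simp only [zero_smul, add_zero]
        rw [hx, bary_centroid k hFne hFk, if_pos hcF, hcard]
        positivity
      exact (((hcont c).tendsto 0).eventually (lt_mem_nhds h0)).filter_mono nhdsWithin_le_nhds
        |>.mono fun t ht => ht.le
  obtain ⟨t, htk, ht⟩ := (hyk.and (Ioo_mem_nhdsGT (zero_lt_one (α := ℝ)))).exists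
  have hmem := inter_shape_subset j k ⟨hyj t ht, (mem_shape_iff k _).2 htk⟩
  have := bary_eq_zero_of_mem_convexHull j a Set.inter_subset_left (fun hh => h.notMem hh.2) hmem
  rw [hay] at this
  exact ht.1.ne' this

/-- At most one element is attached to a given facet of `j` from outside. -/
theorem AdjacentAcross.unique (hd : 0 < d) {j k k' : M.Cell} {a : j.1} {b : k.1} {b' : k'.1}
    (h : AdjacentAcross j k a b) (h' : AdjacentAcross j k' a b') : k = k' := by
  by_contra hne
  have hkk : AdjacentAcross k k' b b' := ⟨hne, h.2.symm.trans h'.2⟩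
  have h1 := h.bary_opposite_neg hd
  have h2 := h'.bary_opposite_neg hd
  have h3 := hkk.bary_opposite_neg hd
  rw [h.bary_eq] at h2
  exact absurd h2 (not_lt.2 (mul_pos_of_neg_of_neg h3 h1).le)

/-- Every facet of `j` is shared with another element: the points just outside `j` near the
centroid of the facet lie in finitely many elements, one of which contains the centroid. -/
theorem exists_adjacentAcross_of_vertex (hd : 0 < d) (j : M.Cell) (a : j.1) :
    ∃ (k : M.Cell) (b : k.1), AdjacentAcross j k a b := by
  set F := j.1.erase a with hF
  have hcard : F.card = d := by rw [hF, Finset.card_erase_of_mem a.2, j.2.2]; rfl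
  have hFne : F.Nonempty := by rw [← Finset.card_pos, hcard]; exact hd
  have hFj : F ⊆ j.1 := Finset.erase_subset _ _
  set x := F.centroid ℝ id with hx
  have hbx : ∀ c : j.1, bary j c x = if (c : E d) ∈ F then (F.card : ℝ)⁻¹ else 0 :=
    fun c => bary_centroid j hFne hFj c
  have hxj : x ∈ j.shape := (mem_shape_iff j x).2 fun c => by rw [hbx]; positivity
  set y : ℝ → E d := fun t => x + t • (x - a) with hy
  have hycont : Continuous y := by fun_prop
  set r := ‖x‖ + ‖x - a‖ with hr
  set S : Set M.Cell := {k | k ≠ j ∧ (k.shape ∩ Metric.closedBall 0 r).Nonempty} with hS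
  have hSfin : S.Finite := by
    refine Set.Finite.of_finite_image (f := Subtype.val)
      ((M.locallyFinite r).subset ?_) Subtype.val_injective.injOn
    rintro _ ⟨k, hk, rfl⟩
    exact ⟨k.2.1, k.2.2, hk.2⟩
  have hclosed : IsClosed (⋃ k ∈ S, k.shape) :=
    hSfin.isClosed_biUnion fun k _ => (isCompact_shape k).isClosed
  have hyU : ∀ t ∈ Set.Ioo (0 : ℝ) 1, y t ∈ ⋃ k ∈ S, k.shape := by
    intro t ht
    obtain ⟨s, hs, hsc, hys⟩ := M.covers (y t)
    refine Set.mem_biUnion (x := (⟨s, hs, hsc⟩ : M.Cell)) ⟨?_, y t, hys, ?_⟩ hys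
    · intro e
      have h1 : y t ∈ j.shape := by rw [← e]; exact hys
      have h2 := (mem_shape_iff j _).1 h1 a
      rw [hy, affineMap_apply_add_smul, affineMap_apply_sub, hbx,
        if_neg (Finset.notMem_erase _ _), bary_vertex j a a.2, if_pos rfl] at h2
      linarith [ht.1]
    · rw [mem_closedBall_zero_iff]
      refine (norm_add_le _ _).trans ?_
      rw [norm_smul, Real.norm_of_nonneg ht.1.le, hr]
      nlinarith [norm_nonneg (x - a), ht.2]
  have hxU : x ∈ ⋃ k ∈ S, k.shape := by
    have htend : Filter.Tendsto y (nhdsWithin 0 (Set.Ioi 0)) (nhds x) := by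
      have := (hycont.tendsto 0).mono_left (nhdsWithin_le_nhds (s := Set.Ioi 0))
      simpa [hy] using this
    exact hclosed.mem_of_tendsto htend
      (Filter.eventually_of_mem (Ioo_mem_nhdsGT (zero_lt_one (α := ℝ))) hyU)
  obtain ⟨k, hk, hxk⟩ := Set.mem_iUnion₂.1 hxU
  refine ⟨k, exists_adjacentAcross hk.1.symm a fun c hc => ?_⟩
  by_contra hck
  have h0 := bary_eq_zero_of_mem_convexHull j ⟨c, hFj hc⟩ Set.inter_subset_left
    (fun hh => hck hh.2) (inter_shape_subset j k ⟨hxj, hxk⟩)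
  rw [hbx, if_pos hc, hcard] at h0
  have : (d : ℝ) ≠ 0 := by positivity
  exact inv_ne_zero this h0

end Mesh

/-! ### Normals and the divergence theorem on mesh elements -/

section Normal

variable {d : ℕ} {M : PeriodicMesh d}

theorem face_comm (j k : M.Cell) : face j k = face k j := Set.inter_comm _ _

theorem exists_mem_notMem {j k : M.Cell} (h : j ≠ k) : ∃ a : j.1, (a : E d) ∉ k.1 := by
  by_contra! hh
  refine h (Subtype.ext (Finset.eq_of_subset_of_card_le (fun a ha => hh ⟨a, ha⟩) ?_))
  rw [j.2.2, k.2.2]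

theorem bary_eq_zero_of_mem_inter {j k : M.Cell} {a : j.1} (ha : (a : E d) ∉ k.1) {x : E d}
    (hj : x ∈ j.shape) (hk : x ∈ k.shape) : bary j a x = 0 :=
  bary_eq_zero_of_mem_convexHull j a Set.inter_subset_left (fun hh => ha hh.2)
    (inter_shape_subset j k ⟨hj, hk⟩)

theorem shape_inter_subset_frontier {j k : M.Cell} (h : j ≠ k) :
    j.shape ∩ k.shape ⊆ frontier j.shape := by
  rintro x ⟨hj, hk⟩
  obtain ⟨a, ha⟩ := exists_mem_notMem h
  exact (mem_frontier_shape_iff j x).2 ⟨hj, a, bary_eq_zero_of_mem_inter ha hj hk⟩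

theorem face_eq_inter {j k : M.Cell} (h : j ≠ k) : face j k = j.shape ∩ k.shape := by
  refine Set.Subset.antisymm (Set.inter_subset_inter (isCompact_shape j).isClosed.frontier_subset
    (isCompact_shape k).isClosed.frontier_subset) (Set.subset_inter
    (shape_inter_subset_frontier h) ?_)
  rw [Set.inter_comm]
  exact shape_inter_subset_frontier h.symm

theorem AdjacentAcross.face_eq {j k : M.Cell} {a : j.1} {b : k.1} (h : AdjacentAcross j k a b) :
    face j k = j.shape ∩ {x | bary j a x = 0} := by
  classical
  rw [face_eq_inter h.1]
  ext x
  refine and_congr_right fun hx => ⟨fun hk => bary_eq_zero_of_mem_inter h.notMem hx hk, fun h0 => ?_⟩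
  have hx' := mem_convexHull_of_bary_eq_zero j a hx h0
  rw [h.2] at hx'
  exact convexHull_mono (Finset.coe_subset.2 (Finset.erase_subset _ _)) hx'

theorem volume_affine_eq_zero {φ : E d →ᵃ[ℝ] ℝ} {p : E d} (hp : φ p ≠ 0) :
    volume {x | φ x = 0} = 0 := by
  let s : AffineSubspace ℝ (E d) := (AffineSubspace.mk' (0 : ℝ) ⊥).comap φ
  have hs : (s : Set (E d)) = {x | φ x = 0} := by
    ext x
    simp [s, AffineSubspace.mem_mk']
  rw [← hs]
  refine Measure.addHaar_affineSubspace _ _ fun htop => hp ?_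
  have : p ∈ (s : Set (E d)) := by rw [htop]; trivial
  rwa [hs] at this

/-- Two facet hyperplanes meet in a null set for the surface measure: the cylinder over this set
along the edge joining the opposite vertices is contained in the hyperplane `λ_a + λ_b = 0`. -/
theorem surf_inter_eq_zero (hd : 0 < d) (j : M.Cell) {a b : j.1} (hab : a ≠ b) :
    surf d ({x | bary j a x = 0} ∩ {x | bary j b x = 0}) = 0 := by
  classical
  set v : E d := cellBasis j a - cellBasis j b with hv
  have hva : (bary j a).linear v = 1 := by rw [hv, coord_linear_sub]; simp [hab]
  have hvb : (bary j b).linear v = -1 := by rw [hv, coord_linear_sub]; simp [hab.symm]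
  have h0 : levelMeasure (bary j a) {x | bary j b x = 0} = 0 := by
    rw [levelMeasure_apply_eq_volume hva (measurableSet_affine_eq _ 0)]
    refine measure_mono_null ?_ (volume_affine_eq_zero (φ := bary j a + bary j b) (p := a) ?_)
    · rintro x ⟨-, -, hx⟩
      change bary j b (x - bary j a x • v) = 0 at hx
      change bary j a x + bary j b x = 0
      rw [sub_eq_add_neg, ← neg_smul, affineMap_apply_add_smul, hvb] at hx
      linarith
    · change bary j a a + bary j b a ≠ 0
      rw [bary_vertex j a a.2, bary_vertex j b a.2, if_pos rfl,
        if_neg fun e => hab (Subtype.ext e.symm)]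
      norm_num
  rw [levelMeasure, Measure.smul_apply, ENNReal.smul_def, smul_eq_mul, mul_eq_zero,
    Measure.restrict_apply (measurableSet_affine_eq _ 0)] at h0
  rw [Set.inter_comm]
  refine h0.resolve_left (ENNReal.coe_ne_zero.2 ?_)
  exact inv_ne_zero (nnnorm_ne_zero_iff.2 (affineGrad_bary_ne_zero hd j a))

/-- Neighbours share a facet: a face of smaller dimension has surface measure zero. -/
theorem exists_adjacentAcross_of_mem_nbrSet (hd : 0 < d) {j k : M.Cell} (hk : k ∈ nbrSet j) :
    ∃ a b, AdjacentAcross j k a b := by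
  classical
  obtain ⟨a, ha⟩ := exists_mem_notMem hk.1.symm
  refine ⟨a, exists_adjacentAcross hk.1.symm a fun b hb => ?_⟩
  by_contra hbk
  obtain ⟨hba, hbj⟩ := Finset.mem_erase.1 hb
  refine hk.2 (measure_mono_null ?_
    (surf_inter_eq_zero hd j (a := a) (b := ⟨b, hbj⟩) fun e => hba (by rw [e])))
  rw [face_eq_inter hk.1.symm]
  rintro x ⟨hj, hk'⟩
  exact ⟨bary_eq_zero_of_mem_inter ha hj hk', bary_eq_zero_of_mem_inter (a := ⟨b, hbj⟩) hbk hj hk'⟩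

/-- The unit normal to the facet of `j` opposite to `a`, directed out of `j`. -/
def outwardNormal (j : M.Cell) (a : j.1) : E d :=
  -(‖affineGrad (bary j a)‖⁻¹ • affineGrad (bary j a))

theorem inner_outwardNormal (j : M.Cell) (a : j.1) (v : E d) :
    inner ℝ (outwardNormal j a) v = -(‖affineGrad (bary j a)‖⁻¹ * (bary j a).linear v) := by
  rw [outwardNormal, inner_neg_left, real_inner_smul_left, inner_affineGrad]

theorem AdjacentAcross.bary_nonpos (hd : 0 < d) {j k : M.Cell} {a : j.1} {b : k.1}
    (h : AdjacentAcross j k a b) {z : E d} (hz : z ∈ k.shape) : bary j a z ≤ 0 := by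
  rw [h.bary_eq]
  exact mul_nonpos_of_nonneg_of_nonpos ((mem_shape_iff k z).1 hz b) (h.bary_opposite_neg hd).le

theorem AdjacentAcross.isUnitNormal (hd : 0 < d) {j k : M.Cell} {a : j.1} {b : k.1}
    (h : AdjacentAcross j k a b) : IsUnitNormal j k (outwardNormal j a) := by
  have hg : ‖affineGrad (bary j a)‖ ≠ 0 := norm_ne_zero_iff.2 (affineGrad_bary_ne_zero hd j a)
  rw [IsUnitNormal, h.face_eq]
  refine ⟨?_, fun x hx y hy => ?_, fun x hx z hz => ?_⟩
  · rw [outwardNormal, norm_neg, norm_smul, norm_inv, norm_norm, inv_mul_cancel₀ hg]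
  · have h1 : bary j a x = 0 := hx.2
    have h2 : bary j a y = 0 := hy.2
    rw [inner_outwardNormal, affineMap_apply_sub, h1, h2]; simp
  · have h1 : bary j a x = 0 := hx.2
    rw [inner_outwardNormal, affineMap_apply_sub, h1, sub_zero, neg_nonneg]
    exact mul_nonpos_of_nonneg_of_nonpos (by positivity) (h.bary_nonpos hd hz)

theorem AdjacentAcross.mem_face {j k : M.Cell} {a : j.1} {b : k.1}
    (h : AdjacentAcross j k a b) {c : E d} (hc : c ∈ j.1) (hca : c ≠ a) : c ∈ face j k := by
  rw [h.face_eq]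
  refine ⟨subset_convexHull ℝ _ hc, ?_⟩
  change bary j a c = 0
  rw [bary_vertex j a hc, if_neg hca.symm]

/-- The conditions on the unit normal to a facet shared by two elements determine it. -/
theorem AdjacentAcross.isUnitNormal_eq (hd : 0 < d) {j k : M.Cell} {a : j.1} {b : k.1}
    (h : AdjacentAcross j k a b) {ν : E d} (hν : IsUnitNormal j k ν) : ν = outwardNormal j a := by
  obtain ⟨hn, hperp, hin⟩ := hν
  set g := affineGrad (bary j a) with hg
  have hg0 : ‖g‖ ≠ 0 := norm_ne_zero_iff.2 (affineGrad_bary_ne_zero hd j a)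
  obtain ⟨x₀, hx₀, hx₀a⟩ : ∃ c ∈ j.1, c ≠ a :=
    Finset.exists_mem_ne (by rw [j.2.2]; omega) _
  have hx₀f := h.mem_face hx₀ hx₀a
  set κ : ℝ := inner ℝ ν (a - x₀) with hκ
  -- `ν` and `κ ∇λ` pair equally with the edges from `x₀`, hence are equal
  have key : ∀ z : E d, inner ℝ ν (z - x₀) = κ * bary j a z := by
    intro z
    let φ : E d →ᵃ[ℝ] ℝ := (innerₗ (E d) ν).toAffineMap.comp
      (AffineMap.id ℝ (E d) - AffineMap.const ℝ (E d) x₀)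
    change φ z = κ * bary j a z
    rw [affineMap_eq_sum_bary j φ z, Finset.sum_eq_single a, mul_comm]
    · rfl
    · intro c _ hca
      have : φ c = 0 := hperp x₀ hx₀f c (h.mem_face c.2 fun e => hca (Subtype.ext e))
      rw [this, mul_zero]
    · simp
  have hνg : ν = κ • g := by
    refine ext_inner_right ℝ fun v => ?_
    have h1 := key (x₀ + v)
    have h2 : bary j a x₀ = 0 := by rw [bary_vertex j a hx₀, if_neg hx₀a.symm]
    have h3 := affineMap_apply_add_smul (bary j a) x₀ v 1
    rw [one_smul, one_mul, h2, zero_add] at h3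
    rw [add_sub_cancel_left, h3] at h1
    rw [h1, real_inner_smul_left, hg, inner_affineGrad]
  have hκ0 : κ ≤ 0 := by
    have h1 := hin x₀ hx₀f b (subset_convexHull ℝ _ b.2)
    rw [key] at h1
    nlinarith [h.bary_opposite_neg hd]
  have hκg : κ = -‖g‖⁻¹ := by
    rw [hνg, norm_smul, Real.norm_of_nonpos hκ0] at hn
    rw [eq_neg_iff_add_eq_zero]
    field_simp
    linarith
  rw [hνg, hκg, neg_smul]
  rfl

theorem AdjacentAcross.unitNormal_eq (hd : 0 < d) {j k : M.Cell} {a : j.1} {b : k.1}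
    (h : AdjacentAcross j k a b) : unitNormal j k = outwardNormal j a := by
  have hex : ∃ ν, IsUnitNormal j k ν := ⟨_, h.isUnitNormal hd⟩
  rw [unitNormal, dif_pos hex]
  exact h.isUnitNormal_eq hd hex.choose_spec

theorem AdjacentAcross.outwardNormal_eq_neg (hd : 0 < d) {j k : M.Cell} {a : j.1} {b : k.1}
    (h : AdjacentAcross j k a b) : outwardNormal k b = -outwardNormal j a := by
  symm
  refine h.symm.isUnitNormal_eq hd ?_
  obtain ⟨h1, h2, -⟩ := h.isUnitNormal hd
  refine ⟨by rw [norm_neg, h1], fun x hx y hy => ?_, fun x hx z hz => ?_⟩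
  · rw [face_comm] at hx hy
    rw [inner_neg_left, h2 x hx y hy, neg_zero]
  · rw [face_comm, h.face_eq] at hx
    have hx0 : bary j a x = 0 := hx.2
    rw [inner_neg_left, inner_outwardNormal, affineMap_apply_sub, hx0, sub_zero, neg_neg]
    exact mul_nonneg (by positivity) ((mem_shape_iff j z).1 hz a)

theorem normal_eq (j k : M.Cell) : normal j k = (surf d).real (face j k) • unitNormal j k := by
  rw [normal, setIntegral_const]

theorem normal_comm (hd : 0 < d) {j k : M.Cell} (hk : k ∈ nbrSet j) :
    normal k j = -normal j k := by
  obtain ⟨a, b, h⟩ := exists_adjacentAcross_of_mem_nbrSet hd hk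
  rw [normal_eq, normal_eq, face_comm k j, h.unitNormal_eq hd, h.symm.unitNormal_eq hd,
    h.outwardNormal_eq_neg hd, smul_neg]

theorem mem_nbrs {j k : M.Cell} : k ∈ nbrs j ↔ k ∈ nbrSet j := Set.Finite.mem_toFinset _

theorem mem_nbrSet_comm {j k : M.Cell} : k ∈ nbrSet j ↔ j ∈ nbrSet k := by
  rw [nbrSet, nbrSet, Set.mem_ofPred_eq, Set.mem_ofPred_eq, ne_comm, face_comm]

variable {V : Type*} [NormedAddCommGroup V] [NormedSpace ℝ V]

theorem levelMeasure_restrict (φ : E d →ᵃ[ℝ] ℝ) {K : Set (E d)} (hK : MeasurableSet K) :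
    (levelMeasure φ).restrict K =
      ‖affineGrad φ‖₊⁻¹ • (surf d).restrict (K ∩ {x | φ x = 0}) := by
  rw [levelMeasure, Measure.restrict_smul, Measure.restrict_restrict hK]

theorem surf_lt_top (hd : 0 < d) (j : M.Cell) (a : j.1) :
    surf d (j.shape ∩ {x | bary j a x = 0}) < ⊤ := by
  have h1 : levelMeasure (bary j a) j.shape < ⊤ := (isCompact_shape j).measure_lt_top
  rw [levelMeasure, Measure.smul_apply,
    Measure.restrict_apply (isCompact_shape j).measurableSet, ENNReal.smul_def, smul_eq_mul] at h1
  have h2 : ((‖affineGrad (bary j a)‖₊⁻¹ : NNReal) : ENNReal) ≠ 0 := by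
    rw [ENNReal.coe_ne_zero]
    exact inv_ne_zero (nnnorm_ne_zero_iff.2 (affineGrad_bary_ne_zero hd j a))
  exact ENNReal.lt_top_of_mul_ne_top_right h1.ne h2

theorem surf_face_lt_top (hd : 0 < d) {j k : M.Cell} (hk : k ∈ nbrSet j) :
    surf d (face j k) < ⊤ := by
  obtain ⟨a, b, h⟩ := exists_adjacentAcross_of_mem_nbrSet hd hk
  rw [h.face_eq]
  exact surf_lt_top hd j a

/-- The divergence theorem on a mesh element, with the boundary integral split over the
neighbours. Facets correspond to neighbours, except those of surface measure zero, which do not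
contribute. -/
theorem integral_shape_fderiv [CompleteSpace V] (hd : 0 < d) (j : M.Cell) {f : E d → V}
    (hf : ContDiff ℝ 1 f) (v : E d) :
    ∫ x in j.shape, fderiv ℝ f x v =
      ∑ k ∈ nbrs j, (inner ℝ (normal j k) v : ℝ) • ⨍ x in face j k, f x ∂(surf d) := by
  classical
  choose nbr opp hadj using exists_adjacentAcross_of_vertex hd j
  have hinj : Function.Injective nbr := by
    intro a a' e
    by_contra hne
    have h1 := (hadj a).notMem
    rw [e] at h1
    exact h1 ((hadj a').symm.mem_of_ne a.2 fun e => hne (Subtype.ext e)).1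
  have hterm : ∀ a : j.1, -((bary j a).linear v • ∫ x in j.shape, f x ∂levelMeasure (bary j a)) =
      (inner ℝ (normal j (nbr a)) v : ℝ) • ⨍ x in face j (nbr a), f x ∂(surf d) := by
    intro a
    rw [levelMeasure_restrict _ (isCompact_shape j).measurableSet, ← (hadj a).face_eq,
      integral_smul_nnreal_measure, normal_eq, (hadj a).unitNormal_eq hd, real_inner_smul_left,
      inner_outwardNormal, mul_comm, mul_smul, measure_smul_setAverage, neg_smul, mul_comm,
      mul_smul]
    · rfl
    · rw [(hadj a).face_eq]; exact (surf_lt_top hd j a).ne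
  rw [shape_eq, integral_convexHull_fderiv (cellBasis j) hf v, ← Finset.sum_neg_distrib, ← shape_eq,
    Finset.sum_congr rfl fun a _ => hterm a]
  rw [← Finset.sum_image (s := Finset.univ) (g := nbr)
    (f := fun k => (inner ℝ (normal j k) v : ℝ) • ⨍ x in face j k, f x ∂(surf d))
    fun a _ a' _ e => hinj e]
  symm
  refine Finset.sum_subset (fun k hk => ?_) fun k hk' hk => ?_
  · obtain ⟨a, b, h⟩ := exists_adjacentAcross_of_mem_nbrSet hd (mem_nbrs.1 hk)
    exact Finset.mem_image.2 ⟨a, Finset.mem_univ a, ((hadj a).unique hd h)⟩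
  · obtain ⟨a, -, rfl⟩ := Finset.mem_image.1 hk'
    have h0 : surf d (face j (nbr a)) = 0 := by
      by_contra h0
      exact hk (mem_nbrs.2 ⟨(hadj a).1.symm, h0⟩)
    rw [normal_eq, measureReal_def, h0, ENNReal.toReal_zero, zero_smul, inner_zero_left, zero_smul]

end Normal

/-! ### Polynomial functions under translations -/

section Polynomial

variable {d : ℕ}

theorem mem_polyFun {q : ℕ} {g : E d → ℂ} : g ∈ polyFun d q ↔
    ∃ P : MvPolynomial (Fin d) ℂ, P.totalDegree ≤ q ∧
      MvPolynomial.aeval (fun (i : Fin d) (x : E d) => ((x i : ℝ) : ℂ)) P = g := by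
  simp only [polyFun, Submodule.mem_map, MvPolynomial.mem_restrictTotalDegree]
  rfl

theorem polyFun_mono {q r : ℕ} (h : q ≤ r) : polyFun d q ≤ polyFun d r := fun g hg => by
  obtain ⟨P, hP, rfl⟩ := mem_polyFun.1 hg
  exact mem_polyFun.2 ⟨P, hP.trans h, rfl⟩

theorem coord_mul_mem_polyFun {q : ℕ} {g : E d → ℂ} (i : Fin d) (hg : g ∈ polyFun d q) :
    (fun x => ((x i : ℝ) : ℂ) * g x) ∈ polyFun d (q + 1) := by
  obtain ⟨P, hP, rfl⟩ := mem_polyFun.1 hg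
  refine mem_polyFun.2 ⟨MvPolynomial.X i * P, ?_, ?_⟩
  · refine (MvPolynomial.totalDegree_mul _ _).trans ?_
    rw [MvPolynomial.totalDegree_X]; omega
  · rw [map_mul, MvPolynomial.aeval_X]; rfl

/-- The monomial function `x ↦ x ^ s`. -/
def monoFun (s : Fin d →₀ ℕ) (x : E d) : ℂ := ∏ i, ((x i : ℝ) : ℂ) ^ s i

theorem aeval_monomial_eq (s : Fin d →₀ ℕ) (c : ℂ) :
    MvPolynomial.aeval (fun (i : Fin d) (x : E d) => ((x i : ℝ) : ℂ))
      (MvPolynomial.monomial s c) = c • monoFun s := by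
  rw [MvPolynomial.aeval_monomial, Algebra.algebraMap_eq_smul_one, smul_mul_assoc, one_mul,
    Finsupp.prod_fintype _ _ fun i => pow_zero _]
  congr 1
  ext x
  simp [monoFun]

theorem monoFun_mem_polyFun {s : Fin d →₀ ℕ} {q : ℕ} (hs : s.degree ≤ q) :
    monoFun s ∈ polyFun d q := by
  refine mem_polyFun.2 ⟨MvPolynomial.monomial s 1, ?_, ?_⟩
  · exact (MvPolynomial.totalDegree_monomial_le _ _).trans hs
  · rw [aeval_monomial_eq, one_smul]

theorem polyFun_induction {q : ℕ} (W : Submodule ℂ (E d → ℂ))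
    (h : ∀ s : Fin d →₀ ℕ, s.degree ≤ q → monoFun s ∈ W) : polyFun d q ≤ W := by
  intro g hg
  obtain ⟨P, hP, rfl⟩ := mem_polyFun.1 hg
  rw [P.as_sum, map_sum]
  refine W.sum_mem fun s hs => ?_
  rw [aeval_monomial_eq]
  exact W.smul_mem _ (h s ((MvPolynomial.le_totalDegree hs).trans hP))

theorem contDiff_of_mem_polyFun {q : ℕ} {g : E d → ℂ} (hg : g ∈ polyFun d q) :
    ContDiff ℝ 1 g := by
  let W : Submodule ℂ (E d → ℂ) :=
    { carrier := {g | ContDiff ℝ 1 g}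
      add_mem' := fun {f g} (hf : ContDiff ℝ 1 f) (hg : ContDiff ℝ 1 g) =>
        show ContDiff ℝ 1 (f + g) from hf.add hg
      zero_mem' := show ContDiff ℝ 1 (fun _ => (0 : ℂ)) from contDiff_const
      smul_mem' := fun c g (hg : ContDiff ℝ 1 g) =>
        show ContDiff ℝ 1 (c • g) from hg.const_smul c }
  refine polyFun_induction W (fun s _ => ?_) hg
  change ContDiff ℝ 1 (fun x : E d => ∏ i, ((x i : ℝ) : ℂ) ^ s i)
  refine contDiff_prod fun i _ => ContDiff.pow ?_ _
  exact Complex.ofRealCLM.contDiff.comp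
    (EuclideanSpace.proj i : E d →L[ℝ] ℝ).contDiff

theorem monoFun_shift_sub_mem (t : E d) : ∀ (m : ℕ) (s : Fin d →₀ ℕ), s.degree = m →
    ∀ q, m ≤ q + 1 → (fun x => monoFun s (x + t) - monoFun s x) ∈ polyFun d q := by
  intro m
  induction m with
  | zero =>
    intro s hs q _
    have : s = 0 := (Finsupp.degree_eq_zero_iff s).1 hs
    subst this
    convert (polyFun d q).zero_mem using 1
    ext x
    simp [monoFun]
  | succ m ih =>
    intro s hs q hq
    have hs0 : s ≠ 0 := by rintro rfl; simp at hs
    obtain ⟨i, hi⟩ := Finsupp.ne_iff.1 hs0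
    obtain ⟨s', rfl⟩ : ∃ s', s = Finsupp.single i 1 + s' :=
      exists_add_of_le (Finsupp.single_le_iff.2 (Nat.one_le_iff_ne_zero.2 hi))
    have hs' : s'.degree = m := by
      rw [map_add, Finsupp.degree_single] at hs; omega
    have hmul : ∀ x : E d, monoFun (Finsupp.single i 1 + s') x = ((x i : ℝ) : ℂ) * monoFun s' x := by
      intro x
      simp only [monoFun, Finsupp.add_apply, pow_add, Finset.prod_mul_distrib]
      congr 1
      rw [Finset.prod_eq_single i]
      · simp
      · intro b _ hb; rw [Finsupp.single_eq_of_ne hb, pow_zero]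
      · simp
    have h1 : monoFun s' ∈ polyFun d q := monoFun_mem_polyFun (by omega)
    have h2 := ih s' hs' q (by omega)
    have h3 : (fun x : E d => ((x i : ℝ) : ℂ) * (monoFun s' (x + t) - monoFun s' x))
        ∈ polyFun d q := by
      rcases q with _ | q
      · have : s' = 0 := (Finsupp.degree_eq_zero_iff s').1 (by omega)
        subst this
        convert (polyFun d 0).zero_mem using 1
        ext x
        simp [monoFun]
      · exact coord_mul_mem_polyFun i (ih s' hs' q (by omega))
    convert (polyFun d q).add_mem h3
      ((polyFun d q).smul_mem ((t i : ℝ) : ℂ) ((polyFun d q).add_mem h2 h1)) using 1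
    ext x
    simp only [hmul, Pi.add_apply, Pi.smul_apply, smul_eq_mul, PiLp.add_apply, Complex.ofReal_add]
    ring

/-- Translation differences lower the degree of a polynomial. -/
theorem shift_sub_mem_polyFun {q : ℕ} {g : E d → ℂ} (t : E d) (hg : g ∈ polyFun d (q + 1)) :
    (fun x => g (x + t) - g x) ∈ polyFun d q := by
  let L : (E d → ℂ) →ₗ[ℂ] (E d → ℂ) :=
    { toFun := fun g x => g (x + t) - g x
      map_add' := fun f g => by ext x; simp only [Pi.add_apply]; ring
      map_smul' := fun c f => by ext x; simp [mul_sub] }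
  exact polyFun_induction ((polyFun d q).comap L)
    (fun s hs => monoFun_shift_sub_mem t _ s rfl q hs) hg

theorem shift_mem_polyFun {q : ℕ} {g : E d → ℂ} (t : E d) (hg : g ∈ polyFun d q) :
    (fun x => g (x + t)) ∈ polyFun d q := by
  have h := shift_sub_mem_polyFun t (polyFun_mono q.le_succ hg)
  convert (polyFun d q).add_mem h hg using 1
  ext x
  simp

end Polynomial

/-! ### Translations of the mesh -/

section Shift

variable {d : ℕ} {M : PeriodicMesh d}

theorem add_mem_shape_shift_iff (T : Fin d → ℤ) (j : M.Cell) (x : E d) :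
    x + latticeVec T ∈ (j.shift T).shape ↔ x ∈ j.shape := by
  have h : (j.shift T).shape = (fun x => x + latticeVec T) '' j.shape := by
    have := (AffineEquiv.vaddConst ℝ (latticeVec T)).toAffineMap.image_convexHull (j.1 : Set (E d))
    simp only [Cell.shape, Cell.shift, translate, Finset.coe_map]
    exact this.symm
  rw [h, (add_left_injective (latticeVec T)).mem_set_image]

theorem preimage_shape_shift (T : Fin d → ℤ) (j : M.Cell) :
    (fun x => x + latticeVec T) ⁻¹' (j.shift T).shape = j.shape :=
  Set.ext fun x => add_mem_shape_shift_iff T j x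

theorem preimage_face_shift (T : Fin d → ℤ) (j k : M.Cell) :
    (fun x => x + latticeVec T) ⁻¹' face (j.shift T) (k.shift T) = face j k := by
  have h := (Homeomorph.addRight (latticeVec T)).preimage_frontier
  simp only [Homeomorph.coe_addRight] at h
  rw [face, Set.preimage_inter, h, h, preimage_shape_shift, preimage_shape_shift, face]

theorem add_mem_face_shift_iff (T : Fin d → ℤ) (j k : M.Cell) (x : E d) :
    x + latticeVec T ∈ face (j.shift T) (k.shift T) ↔ x ∈ face j k := by
  rw [← preimage_face_shift T j k]; rfl

theorem surf_face_shift (T : Fin d → ℤ) (j k : M.Cell) :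
    surf d (face (j.shift T) (k.shift T)) = surf d (face j k) := by
  rw [← preimage_face_shift T j k, measure_preimage_add_right]

theorem setAverage_shift {V : Type*} [NormedAddCommGroup V] [NormedSpace ℝ V]
    (μ : Measure (E d)) [μ.IsAddRightInvariant] (t : E d) (s : Set (E d)) (f : E d → V) :
    ⨍ x in s, f x ∂μ = ⨍ x in (fun x => x + t) ⁻¹' s, f (x + t) ∂μ := by
  rw [setAverage_eq, setAverage_eq, measureReal_def, measureReal_def,
    measure_preimage_add_right μ t s,
    (measurePreserving_add_right μ t).setIntegral_preimage_emb
      (Homeomorph.addRight t).measurableEmbedding f s]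

theorem cellAvg_shift {V : Type*} [NormedAddCommGroup V] [NormedSpace ℝ V] (f : E d → V)
    (T : Fin d → ℤ) (j : M.Cell) :
    cellAvg f (j.shift T) = cellAvg (fun x => f (x + latticeVec T)) j := by
  rw [cellAvg, cellAvg, setAverage_shift volume (latticeVec T), preimage_shape_shift]

theorem shift_neg_shift (T : Fin d → ℤ) (j : M.Cell) : (j.shift T).shift (-T) = j := by
  rw [Cell.shift_shift, add_neg_cancel, Cell.shift_zero]

theorem shift_shift_neg (T : Fin d → ℤ) (j : M.Cell) : (j.shift (-T)).shift T = j := by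
  rw [Cell.shift_shift, neg_add_cancel, Cell.shift_zero]

theorem shift_inj {T : Fin d → ℤ} {j k : M.Cell} : j.shift T = k.shift T ↔ j = k :=
  ⟨fun h => by rw [← shift_neg_shift T j, h, shift_neg_shift], fun h => by rw [h]⟩

/-- Integer translations act freely on the elements: a nonzero one moves the sum of the
vertices. -/
theorem eq_zero_of_shift_eq {T : Fin d → ℤ} {j : M.Cell} (h : j.shift T = j) : T = 0 := by
  have h1 : ∑ x ∈ translate T j.1, x = ∑ x ∈ j.1, x :=
    congrArg (fun k : M.Cell => ∑ x ∈ k.1, x) h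
  rw [translate, Finset.sum_map] at h1
  simp only [addRightEmbedding_apply, Finset.sum_add_distrib, Finset.sum_const, j.2.2] at h1
  have h2 : ((d + 1 : ℕ) : ℝ) • latticeVec T = 0 := by
    rw [Nat.cast_smul_eq_nsmul]; simpa using h1
  have h3 : latticeVec T = 0 :=
    (smul_eq_zero.1 h2).resolve_left (Nat.cast_ne_zero.2 d.succ_ne_zero)
  ext i
  have := congrArg (fun v : E d => v i) h3
  simpa [latticeVec] using this

theorem shift_mem_nbrSet_iff (T : Fin d → ℤ) (j k : M.Cell) :
    k.shift T ∈ nbrSet (j.shift T) ↔ k ∈ nbrSet j := by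
  simp only [nbrSet, Set.mem_ofPred_eq, surf_face_shift, ne_eq, shift_inj]

theorem isUnitNormal_shift (T : Fin d → ℤ) (j k : M.Cell) :
    IsUnitNormal (j.shift T) (k.shift T) = IsUnitNormal j k := by
  ext ν
  have e : ∀ P : E d → Prop, (∀ x, P x) ↔ ∀ x, P (x + latticeVec T) := fun P =>
    ((Equiv.addRight (latticeVec T)).forall_congr_right (q := P)).symm
  rw [IsUnitNormal, IsUnitNormal, e, e (fun x => x ∈ face _ _ → ∀ z ∈ _, _)]
  refine and_congr_right fun _ => and_congr (forall_congr' fun x => ?_) (forall_congr' fun x => ?_)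
  · rw [add_mem_face_shift_iff, e]
    simp only [add_mem_face_shift_iff, add_sub_add_right_eq_sub]
  · rw [add_mem_face_shift_iff, e]
    simp only [add_mem_shape_shift_iff, add_sub_add_right_eq_sub]

theorem normal_shift (T : Fin d → ℤ) (j k : M.Cell) :
    normal (j.shift T) (k.shift T) = normal j k := by
  rw [normal_eq, normal_eq, measureReal_def, measureReal_def, surf_face_shift, unitNormal,
    unitNormal, isUnitNormal_shift]

/-- Contributions of the faces cancel over one period, if they are antisymmetric and invariant
under translations: the face between `j` and `k` is counted once more, as the face between the
translates of `k` and `j` with `k` moved into the period. -/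
theorem sum_nbrs_eq_zero {V : Type*} [AddCommGroup V] [IsAddTorsionFree V] {R : Finset M.Cell}
    (hR : IsPeriodCell R) (D : M.Cell → M.Cell → V)
    (hanti : ∀ j, ∀ k ∈ nbrs j, D k j = -D j k)
    (hper : ∀ T j k, D (j.shift T) (k.shift T) = D j k) :
    ∑ j ∈ R, ∑ k ∈ nbrs j, D j k = 0 := by
  have hT : ∀ k : M.Cell, ∃ T, k.shift T ∈ R := by
    intro k
    obtain ⟨_, ⟨hk, T, rfl⟩, -⟩ := hR k
    exact ⟨T, hk⟩
  choose τ hτ using hT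
  rw [Finset.sum_sigma']
  have hg : ∀ z : (_ : M.Cell) × M.Cell, z ∈ R.sigma (fun j => nbrs j) →
      D (z.2.shift (τ z.2)) (z.1.shift (τ z.2)) = -D z.1 z.2 := by
    rintro ⟨j, k⟩ hz
    rw [hper, hanti j k (Finset.mem_sigma.1 hz).2]
  refine Finset.sum_involution (fun z _ => ⟨z.2.shift (τ z.2), z.1.shift (τ z.2)⟩)
    (fun z hz => ?_) (fun z hz h0 h => ?_) (fun z hz => ?_) (fun z hz => ?_)
  · rw [hg z hz, add_neg_cancel]
  · have h1 := hg z hz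
    rw [show z.2.shift (τ z.2) = z.1 from congrArg Sigma.fst h,
      show z.1.shift (τ z.2) = z.2 from congrArg (fun w : (_ : M.Cell) × M.Cell => w.2) h] at h1
    exact h0 (self_eq_neg.1 h1)
  · rw [Finset.mem_sigma, mem_nbrs, shift_mem_nbrSet_iff, ← mem_nbrSet_comm, ← mem_nbrs]
    exact ⟨hτ _, (Finset.mem_sigma.1 hz).2⟩
  · obtain ⟨j, k⟩ := z
    have hj : j ∈ R := (Finset.mem_sigma.1 hz).1
    -- both `j` and the translate of `j` chosen by the second step lie in `R`
    have h1 : (j.shift (τ k)).shift (τ (j.shift (τ k))) = j := by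
      refine (hR j).unique ⟨hτ _, _, Cell.shift_shift _ _ _⟩ ⟨hj, 0, j.shift_zero.symm⟩
    have h2 : τ k + τ (j.shift (τ k)) = 0 := by
      rw [Cell.shift_shift] at h1
      exact eq_zero_of_shift_eq h1
    have h3 : (k.shift (τ k)).shift (τ (j.shift (τ k))) = k := by
      rw [Cell.shift_shift, h2, Cell.shift_zero]
    simp only [h1, h3]

end Shift

/-! ### Exactness and translation invariance of the reconstruction -/

section Reconstruction

variable {d : ℕ} {M : PeriodicMesh d} {p : ℕ}

theorem integrableOn_shape {V : Type*} [NormedAddCommGroup V] {f : E d → V}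
    (hf : Continuous f) (j : M.Cell) : IntegrableOn f j.shape :=
  hf.continuousOn.integrableOn_compact (isCompact_shape j)

theorem cellAvg_add {V : Type*} [NormedAddCommGroup V] [NormedSpace ℝ V] {f g : E d → V}
    (hf : Continuous f) (hg : Continuous g) (j : M.Cell) :
    cellAvg (fun x => f x + g x) j = cellAvg f j + cellAvg g j := by
  simp only [cellAvg, setAverage_eq]
  rw [integral_add (integrableOn_shape hf j) (integrableOn_shape hg j),
    smul_add]

theorem continuous_of_mem_polyFun {g : E d → ℂ} {q : ℕ} (hg : g ∈ polyFun d q) : Continuous g :=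
  (contDiff_of_mem_polyFun hg).continuous

theorem poly_spec (𝓡 : PolyReconstruction M p) (j : M.Cell) (u : M.Cell → ℂ) :
    IsReconstruction p (𝓡.stencil j) (𝓡.weight j) j u (𝓡.poly j u) :=
  (𝓡.wellPosed j u).choose_spec.1

theorem eq_poly (𝓡 : PolyReconstruction M p) {j : M.Cell} {u : M.Cell → ℂ} {q : E d → ℂ}
    (h : IsReconstruction p (𝓡.stencil j) (𝓡.weight j) j u q) : q = 𝓡.poly j u :=
  (𝓡.wellPosed j u).choose_spec.2 q h

/-- Adding to the data the averages of a polynomial of `P_p` adds this polynomial to the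
reconstruction: all residuals stay the same. -/
theorem poly_add (𝓡 : PolyReconstruction M p) (j : M.Cell) (u : M.Cell → ℂ) {g : E d → ℂ}
    (hg : g ∈ polyFun d p) :
    𝓡.poly j (fun k => u k + cellAvg g k) = fun x => 𝓡.poly j u x + g x := by
  obtain ⟨hq, h⟩ := poly_spec 𝓡 j u
  have hgc := continuous_of_mem_polyFun hg
  symm
  refine eq_poly 𝓡 ⟨(polyFun d p).add_mem hq hg, ?_⟩
  simp only [cellAvg_add (continuous_of_mem_polyFun hq) hgc]
  split_ifs at h ⊢ with hc
  · intro k hk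
    rw [h k hk]
  · refine ⟨by rw [h.1], fun q' hq' hj => ?_⟩
    have hq'' : (fun x => q' x + -g x) ∈ polyFun d p :=
      (polyFun d p).add_mem hq' ((polyFun d p).neg_mem hg)
    have havg : ∀ k : M.Cell, cellAvg (fun x => q' x + -g x) k = cellAvg q' k - cellAvg g k := by
      intro k
      have hgn : Continuous fun x => -g x := hgc.neg
      rw [cellAvg_add (continuous_of_mem_polyFun hq') hgn, sub_eq_add_neg]
      congr 1
      simp only [cellAvg, setAverage_eq, integral_neg, smul_neg]
    have h1 := h.2 _ hq'' (by rw [havg, hj, add_sub_cancel_right])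
    -- `q' - g` competes for the data `u` with the same residuals as `q'` for `u + Π g`
    convert h1 using 4 with k _ k _
    · congr 1; ring
    · rw [havg]; congr 1; ring

theorem poly_cellAvg_add (𝓡 : PolyReconstruction M p) (j : M.Cell) {f g : E d → ℂ}
    (hf : Continuous f) (hg : g ∈ polyFun d p) :
    𝓡.poly j (fun k => cellAvg (fun x => f x + g x) k) =
      fun x => 𝓡.poly j (fun k => cellAvg f k) x + g x := by
  rw [← poly_add 𝓡 j _ hg]
  congr 1
  ext k
  exact cellAvg_add hf (continuous_of_mem_polyFun hg) k

theorem poly_zero (𝓡 : PolyReconstruction M p) (j : M.Cell) : 𝓡.poly j (fun _ => 0) = 0 := by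
  have h0 : ∀ k : M.Cell, cellAvg (0 : E d → ℂ) k = 0 := fun k => by
    simp [cellAvg]
  refine (eq_poly 𝓡 ⟨(polyFun d p).zero_mem, ?_⟩).symm
  split_ifs with hc
  · exact fun k _ => h0 k
  · refine ⟨h0 j, fun q' _ _ => ?_⟩
    simp only [h0, sub_zero, norm_zero]
    exact Finset.sum_le_sum fun k hk => by
      have := 𝓡.weight_pos j k hk
      simp only [ne_eq, OfNat.ofNat_ne_zero, not_false_eq_true, zero_pow, mul_zero]
      positivity

theorem poly_cellAvg (𝓡 : PolyReconstruction M p) (j : M.Cell) {g : E d → ℂ}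
    (hg : g ∈ polyFun d p) : 𝓡.poly j (fun k => cellAvg g k) = g := by
  have h := poly_add 𝓡 j (fun _ => 0) hg
  simpa [poly_zero] using h

theorem mem_stencil_shift_iff (𝓡 : PolyReconstruction M p) (T : Fin d → ℤ) (j k : M.Cell) :
    k ∈ 𝓡.stencil (j.shift T) ↔ k.shift (-T) ∈ 𝓡.stencil j := by
  rw [← 𝓡.mem_stencil_shift T j, shift_shift_neg]

theorem sum_stencil_shift (𝓡 : PolyReconstruction M p) (T : Fin d → ℤ) (j : M.Cell)
    (F : M.Cell → ℝ) :
    ∑ k ∈ 𝓡.stencil (j.shift T), F k = ∑ k ∈ 𝓡.stencil j, F (k.shift T) := by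
  refine Finset.sum_nbij' (fun k => k.shift (-T)) (fun k => k.shift T)
    (fun k hk => (mem_stencil_shift_iff 𝓡 T j k).1 hk)
    (fun k hk => (𝓡.mem_stencil_shift T j k).2 hk) (fun k _ => shift_shift_neg T k)
    (fun k _ => shift_neg_shift T k) fun k _ => by rw [shift_shift_neg]

theorem card_stencil_shift (𝓡 : PolyReconstruction M p) (T : Fin d → ℤ) (j : M.Cell) :
    (𝓡.stencil (j.shift T)).card = (𝓡.stencil j).card := by
  have h := sum_stencil_shift 𝓡 T j fun _ => 1
  simpa using h

/-- The reconstruction commutes with integer translations. -/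
theorem poly_shift (𝓡 : PolyReconstruction M p) (T : Fin d → ℤ) (j : M.Cell) (u : M.Cell → ℂ) :
    𝓡.poly j (fun k => u (k.shift T)) = fun x => 𝓡.poly (j.shift T) u (x + latticeVec T) := by
  obtain ⟨hq, h⟩ := poly_spec 𝓡 (j.shift T) u
  symm
  refine eq_poly 𝓡 ⟨shift_mem_polyFun _ hq, ?_⟩
  rw [card_stencil_shift] at h
  simp only [← cellAvg_shift]
  split_ifs at h ⊢ with hc
  · exact fun k hk => h _ ((𝓡.mem_stencil_shift T j k).2 hk)
  · refine ⟨h.1, fun q' hq' hj => ?_⟩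
    -- a competitor at `j` is translated to a competitor at the translate of `j`
    have hav : ∀ k : M.Cell,
        cellAvg (fun x => q' (x + -latticeVec T)) (k.shift T) = cellAvg q' k := fun k => by
      rw [cellAvg_shift]; simp
    have h1 := h.2 _ (shift_mem_polyFun (-latticeVec T) hq') (by rw [hav, hj])
    rw [sum_stencil_shift, sum_stencil_shift] at h1
    convert h1 using 1
    · refine Finset.sum_congr rfl fun k hk => ?_
      rw [𝓡.weight_shift T j k hk]
    · refine Finset.sum_congr rfl fun k hk => ?_
      rw [𝓡.weight_shift T j k hk, hav]

/-- The face average of the reconstruction error at the element `j`. -/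
def faceError (𝓡 : PolyReconstruction M p) (g : E d → ℂ) (j k : M.Cell) : ℂ :=
  ⨍ x in face j k, (𝓡.poly j (fun l => cellAvg g l) x - g x) ∂(surf d)

theorem faceError_eq_zero (𝓡 : PolyReconstruction M p) {g : E d → ℂ} (hg : g ∈ polyFun d p)
    (j k : M.Cell) : faceError 𝓡 g j k = 0 := by
  simp [faceError, poly_cellAvg 𝓡 j hg]

theorem faceError_add (𝓡 : PolyReconstruction M p) {f g : E d → ℂ} (hf : Continuous f)
    (hg : g ∈ polyFun d p) (j k : M.Cell) :
    faceError 𝓡 (fun x => f x + g x) j k = faceError 𝓡 f j k := by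
  simp only [faceError, poly_cellAvg_add 𝓡 j hf hg, add_sub_add_right_eq_sub]

/-- On polynomials of degree `p + 1` the reconstruction error is periodic: a translation changes
the polynomial by an element of `P_p`, which is reconstructed exactly. -/
theorem faceError_shift (𝓡 : PolyReconstruction M p) {g : E d → ℂ} (hg : g ∈ polyFun d (p + 1))
    (T : Fin d → ℤ) (j k : M.Cell) :
    faceError 𝓡 g (j.shift T) (k.shift T) = faceError 𝓡 g j k := by
  have h1 : faceError 𝓡 g (j.shift T) (k.shift T) =
      faceError 𝓡 (fun x => g (x + latticeVec T)) j k := by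
    rw [faceError, faceError, setAverage_shift (surf d) (latticeVec T), preimage_face_shift]
    simp only [← cellAvg_shift]
    rw [poly_shift 𝓡 T j (fun l => cellAvg g l)]
  rw [h1, ← faceError_add 𝓡 (continuous_of_mem_polyFun hg)
    (shift_sub_mem_polyFun (latticeVec T) hg) j k]
  simp

theorem integrableOn_face (hd : 0 < d) {j k : M.Cell} (hk : k ∈ nbrSet j) {V : Type*}
    [NormedAddCommGroup V] {f : E d → V} (hf : Continuous f) :
    IntegrableOn f (face j k) (surf d) := by
  have hsub : face j k ⊆ j.shape :=
    Set.inter_subset_left.trans (isCompact_shape j).isClosed.frontier_subset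
  have hmeas : MeasurableSet (face j k) := (isClosed_frontier.inter isClosed_frontier).measurableSet
  obtain ⟨C, hC⟩ := (isCompact_shape j).exists_bound_of_continuousOn hf.continuousOn
  refine Measure.integrableOn_of_bounded (M := C) (surf_face_lt_top hd hk).ne
    hf.aestronglyMeasurable ?_
  exact (ae_restrict_mem hmeas).mono fun x hx => hC x (hsub hx)

theorem setAverage_poly_eq (hd : 0 < d) (𝓡 : PolyReconstruction M p) {g : E d → ℂ}
    (hg : Continuous g) {j k : M.Cell} (hk : k ∈ nbrSet j) :
    ⨍ x in face j k, 𝓡.poly j (fun l => cellAvg g l) x ∂(surf d) =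
      (⨍ x in face j k, g x ∂(surf d)) + faceError 𝓡 g j k := by
  have hq := continuous_of_mem_polyFun (poly_spec 𝓡 j fun l => cellAvg g l).1
  rw [faceError, setAverage_eq, setAverage_eq, setAverage_eq,
    integral_sub (integrableOn_face hd hk hq) (integrableOn_face hd hk hg), smul_sub,
    add_sub_cancel]

end Reconstruction

/-! ### The upwind flux and its defect -/

section Flux

variable {d n p : ℕ} {M : PeriodicMesh d}

theorem act_add_left (B C : Matrix (Fin n) (Fin n) ℝ) (v : Fin n → ℂ) :
    act (B + C) v = act B v + act C v := by
  rw [act, Matrix.map_add _ Complex.ofReal_add, Matrix.add_mulVec]; rfl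

theorem act_add_right (B : Matrix (Fin n) (Fin n) ℝ) (v w : Fin n → ℂ) :
    act B (v + w) = act B v + act B w := Matrix.mulVec_add _ _ _

theorem act_smul_left (r : ℝ) (B : Matrix (Fin n) (Fin n) ℝ) (v : Fin n → ℂ) :
    act (r • B) v = r • act B v := by
  ext i
  simp [act, Matrix.mulVec, dotProduct, Finset.mul_sum, mul_assoc]

theorem act_smul_right (r : ℝ) (B : Matrix (Fin n) (Fin n) ℝ) (v : Fin n → ℂ) :
    act B (r • v) = r • act B v := Matrix.mulVec_smul _ _ _

theorem act_neg_left (B : Matrix (Fin n) (Fin n) ℝ) (v : Fin n → ℂ) :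
    act (-B) v = -act B v := by
  rw [← neg_one_smul ℝ, act_smul_left, neg_one_smul]

theorem act_zero_right (B : Matrix (Fin n) (Fin n) ℝ) : act B 0 = 0 := Matrix.mulVec_zero _

theorem act_sum_left {ι : Type*} (s : Finset ι) (B : ι → Matrix (Fin n) (Fin n) ℝ)
    (v : Fin n → ℂ) : act (∑ i ∈ s, B i) v = ∑ i ∈ s, act (B i) v := by
  classical
  induction s using Finset.induction_on with
  | empty => ext i; simp [act, Matrix.mulVec, dotProduct]
  | insert a s ha ih => rw [Finset.sum_insert ha, Finset.sum_insert ha, act_add_left, ih]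

/-- The action of a real matrix as a continuous linear map. -/
def actL (B : Matrix (Fin n) (Fin n) ℝ) : (Fin n → ℂ) →L[ℝ] (Fin n → ℂ) :=
  LinearMap.toContinuousLinearMap
    { toFun := act B
      map_add' := act_add_right B
      map_smul' := fun r v => act_smul_right r B v }

theorem actL_apply (B : Matrix (Fin n) (Fin n) ℝ) (v : Fin n → ℂ) : actL B v = act B v := rfl

theorem dotA_neg (A : Fin d → Matrix (Fin n) (Fin n) ℝ) (v : E d) : dotA A (-v) = -dotA A v := by
  simp [dotA, Finset.sum_neg_distrib]

theorem matAbs_neg {B S : Matrix (Fin n) (Fin n) ℝ} {l : Fin n → ℝ}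
    (h : IsDiagonalization B S l) : matAbs (-B) = matAbs B := by
  have h' : IsDiagonalization (-B) S (fun i => -l i) := by
    refine ⟨h.1, ?_⟩
    rw [show Matrix.diagonal (fun i => -l i) = -Matrix.diagonal l from
      (Matrix.diagonal_neg l).symm, Matrix.mul_neg, Matrix.neg_mul, ← h.2]
  rw [matAbs_eq h, matAbs_eq h']
  simp

theorem IsPolyVec.contDiff {q : ℕ} {f : E d → Fin n → ℂ} (hf : IsPolyVec q f) : ContDiff ℝ 1 f :=
  contDiff_pi.2 fun i => contDiff_of_mem_polyFun (hf i)

theorem integral_shape_advect (hd : 0 < d) (A : Fin d → Matrix (Fin n) (Fin n) ℝ)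
    {f : E d → Fin n → ℂ} (hf : ContDiff ℝ 1 f) (j : M.Cell) :
    ∫ x in j.shape, advect A f x =
      ∑ k ∈ nbrs j, act (dotA A (normal j k)) (⨍ x in face j k, f x ∂(surf d)) := by
  have hi : ∀ i : Fin d, Integrable (fun x => fderiv ℝ f x (EuclideanSpace.single i 1))
      (volume.restrict j.shape) := fun i =>
    integrableOn_shape ((hf.continuous_fderiv one_ne_zero).clm_apply continuous_const) j
  simp only [advect, ← actL_apply]
  rw [integral_finsetSum _ fun i _ => (actL (A i)).integrable_comp (hi i)]
  simp only [(actL (A _)).integral_comp_comm (hi _), integral_shape_fderiv hd j hf, map_sum,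
    map_smul]
  rw [Finset.sum_comm]
  refine Finset.sum_congr rfl fun k _ => ?_
  rw [actL_apply, dotA, act_sum_left]
  refine Finset.sum_congr rfl fun i _ => ?_
  rw [act_smul_left, EuclideanSpace.inner_single_right]
  simp [actL_apply]

/-- The difference between the upwind flux and the exact flux through the face between `j` and
`k`: the upwind splitting applied to the reconstruction errors on the two sides. -/
def fluxDefect (𝓡 : PolyReconstruction M p) (A : Fin d → Matrix (Fin n) (Fin n) ℝ)
    (f : E d → Fin n → ℂ) (j k : M.Cell) : Fin n → ℂ :=
  act ((1 / 2 : ℝ) • (dotA A (normal j k) + matAbs (dotA A (normal j k))))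
      (fun i => faceError 𝓡 (fun x => f x i) j k) +
    act ((1 / 2 : ℝ) • (dotA A (normal j k) - matAbs (dotA A (normal j k))))
      (fun i => faceError 𝓡 (fun x => f x i) k j)

theorem setAverage_apply {μ : Measure (E d)} {s : Set (E d)} {f : E d → Fin n → ℂ}
    (hf : IntegrableOn f s μ) (i : Fin n) : (⨍ x in s, f x ∂μ) i = ⨍ x in s, f x i ∂μ := by
  have h : ∀ i, IntegrableOn (fun x => f x i) s μ := fun i =>
    (ContinuousLinearMap.proj (R := ℝ) (φ := fun _ : Fin n => ℂ) i).integrable_comp hf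
  rw [setAverage_eq, setAverage_eq, Pi.smul_apply, eval_integral h]

theorem cellAvg_apply {f : E d → Fin n → ℂ} (hf : Continuous f) (j : M.Cell) (i : Fin n) :
    cellAvg f j i = cellAvg (fun x => f x i) j :=
  setAverage_apply (integrableOn_shape hf j) i

theorem recon_eq (hd : 0 < d) (𝓡 : PolyReconstruction M p) {f : E d → Fin n → ℂ}
    (hf : Continuous f) {j k : M.Cell} (hk : k ∈ nbrSet j) :
    𝓡.recon j k (fun l => cellAvg f l) =
      (⨍ x in face j k, f x ∂(surf d)) + fun i => faceError 𝓡 (fun x => f x i) j k := by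
  ext i
  have hi : Continuous fun x => f x i := (continuous_apply i).comp hf
  rw [Pi.add_apply, setAverage_apply (integrableOn_face hd hk hf),
    ← setAverage_poly_eq hd 𝓡 hi hk]
  simp only [PolyReconstruction.recon, cellAvg_apply hf]

theorem flux_eq (hd : 0 < d) (𝓡 : PolyReconstruction M p) (A : Fin d → Matrix (Fin n) (Fin n) ℝ)
    {f : E d → Fin n → ℂ} (hf : Continuous f) {j k : M.Cell} (hk : k ∈ nbrSet j) :
    𝓡.flux A j k (fun l => cellAvg f l) =
      act (dotA A (normal j k)) (⨍ x in face j k, f x ∂(surf d)) + fluxDefect 𝓡 A f j k := by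
  rw [PolyReconstruction.flux, recon_eq hd 𝓡 hf hk, recon_eq hd 𝓡 hf (mem_nbrSet_comm.1 hk),
    face_comm k j, act_add_right, act_add_right, fluxDefect, add_add_add_comm, ← act_add_left]
  congr 2
  rw [← smul_add, add_add_sub_cancel, ← two_smul ℝ, smul_smul]
  norm_num

theorem vol_pos (j : M.Cell) : 0 < j.vol := by
  refine ENNReal.toReal_pos (Measure.measure_pos_of_nonempty_interior _ ?_).ne'
    (isCompact_shape j).measure_lt_top.ne
  rw [shape_eq]
  exact ⟨_, (cellBasis j).centroid_mem_interior_convexHull⟩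

/-- By the divergence theorem the truncation error is the sum of the flux defects. -/
theorem truncError_eq (hd : 0 < d) (𝓡 : PolyReconstruction M p)
    (A : Fin d → Matrix (Fin n) (Fin n) ℝ) {f : E d → Fin n → ℂ} (hf : ContDiff ℝ 1 f)
    (j : M.Cell) :
    truncError A (𝓡.flux A) f j = (j.vol)⁻¹ • ∑ k ∈ nbrs j, fluxDefect 𝓡 A f j k := by
  rw [truncError, Finset.sum_congr rfl fun k hk => flux_eq hd 𝓡 A hf.continuous (mem_nbrs.1 hk),
    Finset.sum_add_distrib, ← integral_shape_advect hd A hf j, smul_add, ← add_assoc, cellAvg,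
    setAverage_eq, ← Cell.vol, neg_add_cancel, zero_add]

theorem fluxDefect_comm (hd : 0 < d) (𝓡 : PolyReconstruction M p)
    {A : Fin d → Matrix (Fin n) (Fin n) ℝ} (hA : IsHyperbolic A) (f : E d → Fin n → ℂ)
    {j k : M.Cell} (hk : k ∈ nbrSet j) : fluxDefect 𝓡 A f k j = -fluxDefect 𝓡 A f j k := by
  obtain ⟨S, l, h⟩ := hA (normal j k)
  rw [fluxDefect, fluxDefect, normal_comm hd hk, dotA_neg, matAbs_neg h, neg_add, ← act_neg_left,
    ← act_neg_left, add_comm, ← smul_neg, ← smul_neg, neg_add', neg_sub]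
  congr 3
  rw [sub_eq_add_neg, add_comm]

theorem fluxDefect_shift (𝓡 : PolyReconstruction M p) (A : Fin d → Matrix (Fin n) (Fin n) ℝ)
    {f : E d → Fin n → ℂ} (hf : IsPolyVec (p + 1) f) (T : Fin d → ℤ) (j k : M.Cell) :
    fluxDefect 𝓡 A f (j.shift T) (k.shift T) = fluxDefect 𝓡 A f j k := by
  simp only [fluxDefect, normal_shift, faceError_shift 𝓡 (hf _)]

theorem fluxDefect_eq_zero (𝓡 : PolyReconstruction M p) (A : Fin d → Matrix (Fin n) (Fin n) ℝ)
    {f : E d → Fin n → ℂ} (hf : IsPolyVec p f) (j k : M.Cell) : fluxDefect 𝓡 A f j k = 0 := by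
  have h : ∀ j k : M.Cell, (fun i => faceError 𝓡 (fun x => f x i) j k) = 0 := fun j k =>
    funext fun i => faceError_eq_zero 𝓡 (hf i) j k
  rw [fluxDefect, h, h, act_zero_right, act_zero_right, add_zero]

end Flux

end FV

end

theorem mainTheorem2 (d n p : ℕ) (hd : 0 < d) (M : FV.PeriodicMesh d)
    (A : Fin d → Matrix (Fin n) (Fin n) ℝ) (hA : FV.IsHyperbolic A)
    (𝓡 : FV.PolyReconstruction M p) :
    FV.IsExact A (𝓡.flux A) p ∧ FV.HasZeroMeanError A (𝓡.flux A) (p + 1) := by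
  refine ⟨fun f hf j => ?_, fun R hR f hf => ?_⟩
  · rw [FV.truncError_eq hd 𝓡 A hf.contDiff, Finset.sum_eq_zero fun k _ =>
      FV.fluxDefect_eq_zero 𝓡 A hf j k, smul_zero]
  · have h : ∀ j : M.Cell, j.vol • FV.truncError A (𝓡.flux A) f j =
        ∑ k ∈ FV.PeriodicMesh.nbrs j, FV.fluxDefect 𝓡 A f j k := fun j => by
      rw [FV.truncError_eq hd 𝓡 A hf.contDiff, smul_inv_smul₀ (FV.vol_pos j).ne']
    rw [Finset.sum_congr rfl fun j _ => h j]
    exact FV.sum_nbrs_eq_zero hR _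
      (fun j k hk => FV.fluxDefect_comm hd 𝓡 hA f (FV.mem_nbrs.1 hk))
      (FV.fluxDefect_shift 𝓡 A hf)
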